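/- Let $p,q\ge 0$, let $A_1,\dots,A_p>0$ and $B_1,\dots,B_q>0$ satisfy $\sum_{k=1}^pA_k=\sum_{j=1}^qB_j$, and let $a_1,\dots,a_p$, $b_1,\dots,b_q$ be arbitrary complex numbers. Put $$\nu=(2\pi)^{(p-q)/2}\prod_{k=1}^pA_k^{a_k-1/2}\prod_{j=1}^qB_j^{1/2-b_j},\qquad \rho=\prod_{k=1}^pA_k^{A_k}\prod_{j=1}^qB_j^{-B_j},\qquad \mu=\sum_{j=1}^qb_j-\sum_{k=1}^pa_k+\frac{p-q}{2},$$ $$F(z)=\frac{z^\mu}{\nu\rho^z}\,\frac{\prod_{k=1}^p\Gamma(A_kz+a_k)}{\prod_{j=1}^q\Gamma(B_jz+b_j)},$$ where $z^\mu$ is the principal branch. For $m\ge1$ let $$Q_m=\frac{(-1)^{m+1}}{m+1}\left[\sum_{k=1}^p\frac{\mathcal B_{m+1}(a_k)}{A_k^m}-\sum_{j=1}^q\frac{\mathcal B_{m+1}(b_j)}{B_j^m}\right],$$ where $\mathcal B_n(\cdot)$ is the $n$-th Bernoulli polynomial, and define $C_0=1$, $C_r=\frac1r\sum_{m=1}^rQ_mC_{r-m}$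 for $r\ge1$. (a) For each $0<\delta<\pi$, $$F(z)\sim\sum_{r=0}^\infty\frac{C_r}{z^r}\qquad\text{as } z\to\infty \text{ in the sector } |\arg z|<\pi-\delta,$$ that is, for every $n$, $F(z)-\sum_{r=0}^{n-1}C_rz^{-r}=O(z^{-n})$ as $z\to\infty$ in this sector. (b) With $u_m=Q_m/m$, the coefficients are also given by $$C_r=\sum_{\substack{k_1+2k_2+\cdots+rk_r=r\\ k_i\ge0}}\frac{u_1^{k_1}u_2^{k_2}\cdots u_r^{k_r}}{k_1!\,k_2!\cdots k_r!}\quad(r\ge0),\qquad C_r=\sum_{n=1}^r\frac1{n!}\sum_{\substack{k_1+\cdots+k_n=r\\ k_i\ge1}}\ \prod_{i=1}^nu_{k_i}\quad(r\ge1).$$ (c) The (principal) logarithm $\log F$ belongs to the class $\mathcal G$ of functions having a Gevrey-1 asymptotic expansion in some right half-plane. That is, there are a real $\lambda$, complex numbers $\alpha_0,\alpha_1,\dots$ and constants $M,\tau>0$ such that, for all $z$ with $\Re z>\lambda$ and all integers $n\ge1$, $$\left|\log F(z)-\sum_{k=0}^{n-1}\frac{\alpha_k}{z^k}\right|\le\frac{M\tau^n\,n!}{|z|^n}.$$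 -/

import Mathlib

open Filter Asymptotics Bornology

noncomputable section

/-- `f(z) ∼ ∑ α_k z^{-k}` as `z → ∞` in `D` (Poincaré type asymptotic expansion): for every `n`,
`f(z) - ∑_{k<n} α_k z^{-k} = O(z^{-n})` as `D ∋ z → ∞`. -/
def HasPoincareExpansion (f : ℂ → ℂ) (α : ℕ → ℂ) (D : Set ℂ) : Prop :=
  ∀ n : ℕ, (fun z : ℂ => f z - ∑ k ∈ Finset.range n, α k / z ^ k)
    =O[cobounded ℂ ⊓ 𝓟 D] (fun z : ℂ => 1 / z ^ n)

/-- The asymptotic expansion `f(z) ∼ ∑ α_k z^{-k}` in `D` is Gevrey of order 1: the remainders are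
bounded by `M τ^n n! / |z|^n`, uniformly for `z ∈ D` and `n ≥ 1`. -/
def HasGevreyOneExpansion (f : ℂ → ℂ) (α : ℕ → ℂ) (D : Set ℂ) : Prop :=
  HasPoincareExpansion f α D ∧
    ∃ M τ : ℝ, 0 < M ∧ 0 < τ ∧ ∀ z ∈ D, ∀ n : ℕ, 1 ≤ n →
      ‖f z - ∑ k ∈ Finset.range n, α k / z ^ k‖ ≤ M * τ ^ n * (n.factorial : ℝ) / ‖z‖ ^ n

/-- The class `𝒢`: functions with a Gevrey-1 expansion in some right half-plane `Re z > lam`. -/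
def GevreyClass : Set (ℂ → ℂ) :=
  {f | ∃ (lam : ℝ) (α : ℕ → ℂ), HasGevreyOneExpansion f α {z : ℂ | lam < z.re}}

/-- The sector `|arg z| < π - δ` (without its vertex). -/
def openSector (δ : ℝ) : Set ℂ := {z : ℂ | z ≠ 0 ∧ |z.arg| < Real.pi - δ}

namespace GammaRatio

variable {p q : ℕ} (A : Fin p → ℝ) (B : Fin q → ℝ) (a : Fin p → ℂ) (b : Fin q → ℂ)

/-- `ν = (2π)^{(p-q)/2} ∏ A_k^{a_k-1/2} ∏ B_j^{1/2-b_j}`. -/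
def nu : ℂ :=
  (((2 * Real.pi) ^ (((p : ℝ) - (q : ℝ)) / 2) : ℝ) : ℂ) *
    (∏ k, (A k : ℂ) ^ (a k - 1 / 2)) * ∏ j, (B j : ℂ) ^ (1 / 2 - b j)

/-- `ρ = ∏ A_k^{A_k} ∏ B_j^{-B_j}`. -/
def rho : ℝ := (∏ k, A k ^ A k) * ∏ j, B j ^ (-B j)

/-- `μ = ∑ b_j - ∑ a_k + (p-q)/2`. -/
def mu : ℂ := ∑ j, b j - ∑ k, a k + ((p : ℂ) - (q : ℂ)) / 2

/-- `z^μ / (ν ρ^z) · ∏ Γ(A_k z + a_k) / ∏ Γ(B_j z + b_j)`, with the principal branch of `z^μ`. -/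
def normalizedRatio (z : ℂ) : ℂ :=
  z ^ mu a b / (nu A B a b * (rho A B : ℂ) ^ z) *
    ((∏ k, Complex.Gamma ((A k : ℂ) * z + a k)) / ∏ j, Complex.Gamma ((B j : ℂ) * z + b j))

/-- `Q_m = (-1)^{m+1}/(m+1) · (∑ 𝓑_{m+1}(a_k)/A_k^m - ∑ 𝓑_{m+1}(b_j)/B_j^m)`, with `𝓑` the
Bernoulli polynomials. -/
def Q (m : ℕ) : ℂ :=
  (-1) ^ (m + 1) / ((m : ℂ) + 1) *
    (∑ k, Polynomial.aeval (a k) (Polynomial.bernoulli (m + 1)) / (A k : ℂ) ^ m -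
      ∑ j, Polynomial.aeval (b j) (Polynomial.bernoulli (m + 1)) / (B j : ℂ) ^ m)

/-- The coefficients `C_r`: `C_0 = 1` and `C_r = (1/r) ∑_{m=1}^{r} Q_m C_{r-m}` for `r ≥ 1`. -/
def C : ℕ → ℂ
  | 0 => 1
  | r + 1 => 1 / ((r : ℂ) + 1) * ∑ m : Fin (r + 1), Q A B a b (m.1 + 1) * C (r - m.1)
  decreasing_by omega

theorem C_zero : C A B a b 0 = 1 := by
  rw [C]

theorem C_succ (r : ℕ) : C A B a b (r + 1) =
    1 / ((r : ℂ) + 1) * ∑ m ∈ Finset.range (r + 1), Q A B a b (m + 1) * C A B a b (r - m) := by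
  rw [C, Finset.sum_range]

end GammaRatio

end

/-!
Everything rests on a version of Stirling's formula for `Γ(z + a)` with complex shift `a`, an exact
remainder, and Gevrey bounds that are uniform in sectors. Let `Φ(z) = (z + a - 1/2) log z - z`. The
decrement from `z` to `z + 1` of `log Γ(z + a) - Φ(z)` is an elementary function `step a` of
`w = 1/z`, analytic at `w = 0` and `O(w²)`. Hence `J(z) = ∑ₖ step a (1/(z+k))` converges, and
telescoping the exponentials gives Gauss's product, so that
`Γ(z + a) = √(2π) exp (Φ(z) + J(z))` (`Gamma_add_eq_exp`); the constant comes from Stirling's formula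
for `n!`.

The expansion `J ∼ ∑ c_m z^{-m}`, with `c_m = (-1)^(m+1) 𝓑_{m+1}(a) / (m(m+1))`, comes from the formal
identity `step a w = ∑ c_m (w^m - (w/(1+w))^m)` (`stepCoeff_eq_sum`), which is the recurrence of the
Bernoulli polynomials: as `w/(1+w) = 1/(z+1)`, each summand telescopes to `c_m z^{-m}`. Truncating the
identity at `m < n` leaves a power series starting at `w^(n+1)`; since `|𝓑_m(a)| ≤ 2 T^m m!`, it is
bounded by a multiple of `T^(2n) n! |w|^(n+1)` (`norm_step_sub_sum_le`). Summation over the points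
`z + k` is harmless wherever `|z + t| ≥ c (|z| + t)` for all `t ≥ 0`, a condition that defines the
sets `cone c`. These are stable under positive scaling and contain half-planes and the sectors
`|arg z| < π - δ`.

In the ratio all elementary factors cancel, so `F = exp L` with `L ∼ ∑ (Q_m/m) z^{-m}` of Gevrey
type. As `L → 0`, it is the principal logarithm of `F` near infinity. The expansion of `F` is the
exponential of that of `L`: the truncations `P` of `∑ u_m w^m` and `S` of `∑ C_r w^r` satisfy
`(S e^{-P})' = O(w^(n-1))` because of the recurrence for `C_r`. The same recurrence identifies `C_r`
with the coefficients of the formal series `exp (∑ u_m X^m)`, whose powers are expanded over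
compositions, or over partitions by the multinomial theorem.
-/

noncomputable section

/-! ### The coefficients of the Stirling series -/

namespace ShiftedStirling

/-- The coefficient `(-1)^(m+1) 𝓑_{m+1}(a) / (m(m+1))` of `z^{-m}` in the Stirling series of
`log Γ(z + a)`. For `m = 0` it is `0`, because of the division by zero. -/
def coeff (a : ℂ) (m : ℕ) : ℂ :=
  (-1) ^ (m + 1) / ((m : ℂ) * (m + 1)) * Polynomial.aeval a (Polynomial.bernoulli (m + 1))

/-- The decrement `Φ(z+1) - Φ(z) - log (z+a)` of `log Γ(z+a) - Φ(z)`, where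
`Φ(z) = (z+a-1/2) log z - z`, written as a function of `w = 1/z`. -/
def step (a w : ℂ) : ℂ :=
  (1 / w + a + 1 / 2) * Complex.log (1 + w) - 1 - Complex.log (1 + a * w)

/-- The Taylor coefficients of `step a` at `0`. -/
def stepCoeff (a : ℂ) (j : ℕ) : ℂ :=
  if j = 0 then 0 else (-1) ^ j * (a ^ j / j + 1 / ((j : ℂ) + 1) - (a + 1 / 2) / j)

/-- The Taylor coefficients of `w^m - (w/(1+w))^m` at `0`. -/
def powDiffCoeff (m j : ℕ) : ℂ :=
  if m < j then -(-1) ^ (j - m) * ((j - 1).choose (j - m) : ℂ) else 0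

theorem hasSum_of_eq {f g : ℕ → ℂ} {x y : ℂ} (h : HasSum g y) (hf : ∀ j, f j = g j)
    (hx : x = y) : HasSum f x := by
  rwa [funext hf, hx]

theorem coeff_zero (a : ℂ) : coeff a 0 = 0 := by simp [coeff]

theorem sum_choose_mul_aeval_bernoulli (a : ℂ) (n : ℕ) :
    ∑ k ∈ Finset.range (n + 1),
      ((n + 1).choose k : ℂ) * Polynomial.aeval a (Polynomial.bernoulli k) = (n + 1) * a ^ n := by
  have h := congrArg (Polynomial.aeval a) (Polynomial.sum_bernoulli n)
  simpa [map_sum, Polynomial.aeval_monomial, Nat.cast_smul_eq_nsmul, add_mul] using h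

theorem aeval_bernoulli_zero (a : ℂ) :
    Polynomial.aeval a (Polynomial.bernoulli 0) = (1 : ℂ) := by simp

theorem aeval_bernoulli_one (a : ℂ) :
    Polynomial.aeval a (Polynomial.bernoulli 1) = a - 1 / 2 := by
  simp

theorem choose_div_mul_succ (j m : ℕ) (hm : 1 ≤ m) (hmj : m < j) :
    ((j - 1).choose (j - m) : ℂ) / ((m : ℂ) * (m + 1)) =
      ((j + 1).choose (m + 1) : ℂ) / ((j : ℂ) * (j + 1)) := by
  obtain ⟨m, rfl⟩ := Nat.exists_eq_add_of_le' hm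
  obtain ⟨j, rfl⟩ := Nat.exists_eq_add_of_le' (show 1 ≤ j by omega)
  have e : (j + 1 - 1).choose (j + 1 - (m + 1)) = j.choose m := by
    rw [Nat.add_sub_cancel, Nat.add_sub_add_right, Nat.choose_symm (by omega)]
  rw [e]
  have h1 := Nat.add_one_mul_choose_eq j m
  have h2 := Nat.add_one_mul_choose_eq (j + 1) (m + 1)
  have h1' : ((j : ℂ) + 1) * (j.choose m) = ((j + 1).choose (m + 1)) * ((m : ℂ) + 1) := by
    exact_mod_cast h1
  have h2' : ((j : ℂ) + 1 + 1) * ((j + 1).choose (m + 1)) =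
      ((j + 1 + 1).choose (m + 1 + 1)) * ((m : ℂ) + 1 + 1) := by exact_mod_cast h2
  have a1 : (j : ℂ) + 1 ≠ 0 := by exact_mod_cast j.succ_ne_zero
  have a2 : (j : ℂ) + 1 + 1 ≠ 0 := by exact_mod_cast (j + 1).succ_ne_zero
  have a3 : (m : ℂ) + 1 ≠ 0 := by exact_mod_cast m.succ_ne_zero
  have a4 : (m : ℂ) + 1 + 1 ≠ 0 := by exact_mod_cast (m + 1).succ_ne_zero
  push_cast
  rw [div_eq_div_iff (by positivity) (by positivity)]
  linear_combination ((j : ℂ) + 1 + 1) * h1' + (m + 1) * h2'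

/-- The formal identity `step a w = ∑ₘ coeff a m (w^m - (w/(1+w))^m)`, coefficient by coefficient.
It is the recurrence `∑_{l ≤ j} (j+1 choose l) 𝓑_l(a) = (j+1) a^j` of the Bernoulli polynomials. -/
theorem stepCoeff_eq_sum (a : ℂ) (j : ℕ) :
    stepCoeff a j = ∑ m ∈ Finset.range j, coeff a m * powDiffCoeff m j := by
  rcases Nat.eq_zero_or_pos j with rfl | hj
  · simp [stepCoeff]
  obtain ⟨i, rfl⟩ := Nat.exists_eq_add_of_le' hj
  have hj0 : ((i : ℂ) + 1) ≠ 0 := by exact_mod_cast i.succ_ne_zero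
  have hj1 : ((i : ℂ) + 1 + 1) ≠ 0 := by exact_mod_cast (i + 1).succ_ne_zero
  have key : ∀ m ∈ Finset.range i, coeff a (m + 1) * powDiffCoeff (m + 1) (i + 1) =
      (-1) ^ (i + 1) / (((i : ℂ) + 1) * (i + 1 + 1)) * (((i + 1 + 1).choose (m + 2) : ℂ) *
        Polynomial.aeval a (Polynomial.bernoulli (m + 2))) := by
    intro m hm
    have hm' : m < i := Finset.mem_range.1 hm
    have h := choose_div_mul_succ (i + 1) (m + 1) (by omega) (by omega)
    rw [Nat.cast_add_one, Nat.cast_add_one] at h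
    have hs : (-1 : ℂ) ^ (m + 1 + 1) * -(-1) ^ (i + 1 - (m + 1)) = (-1) ^ (i + 1) := by
      rw [mul_neg, ← pow_add, show m + 1 + 1 + (i + 1 - (m + 1)) = i + 1 + 1 by omega,
        pow_succ _ (i + 1)]
      ring
    rw [coeff, powDiffCoeff, if_pos (by omega), Nat.cast_add_one]
    calc _ = ((-1 : ℂ) ^ (m + 1 + 1) * -(-1) ^ (i + 1 - (m + 1))) *
          (((i + 1 - 1).choose (i + 1 - (m + 1)) : ℂ) / (((m : ℂ) + 1) * (m + 1 + 1))) *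
          Polynomial.aeval a (Polynomial.bernoulli (m + 2)) := by ring
      _ = _ := by rw [hs, h]; ring
  rw [Finset.sum_range_succ', coeff_zero, zero_mul, add_zero, Finset.sum_congr rfl key,
    ← Finset.mul_sum]
  have h := sum_choose_mul_aeval_bernoulli a (i + 1)
  rw [Finset.sum_range_succ', Finset.sum_range_succ', aeval_bernoulli_zero] at h
  rw [zero_add, aeval_bernoulli_one] at h
  simp only [Nat.choose_zero_right, Nat.choose_one_right] at h
  push_cast at h
  have h' := eq_sub_of_add_eq (eq_sub_of_add_eq h)
  rw [h', stepCoeff, if_neg (by omega)]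
  push_cast
  field_simp
  ring

/-- The growth of the Bernoulli polynomials, from which the factorials in the Gevrey bounds come. -/
theorem norm_aeval_bernoulli_le (a : ℂ) (n : ℕ) :
    ‖Polynomial.aeval a (Polynomial.bernoulli n)‖ ≤ 2 * (2 + ‖a‖) ^ n * n.factorial := by
  set T := 2 + ‖a‖ with hT
  have hT2 : 2 ≤ T := by have := norm_nonneg a; linarith
  have hT0 : 0 < T := by linarith
  induction n using Nat.strong_induction_on with
  | _ n ih =>
    have h := sum_choose_mul_aeval_bernoulli a n
    -- Solve the recurrence for `𝓑_n(a)`. Listed downwards from `n - 1`, the other terms are dominated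
    -- by a geometric series of ratio `1/2`.
    rw [Finset.sum_range_succ, Nat.choose_succ_self_right, ← Finset.sum_range_reflect] at h
    push_cast at h
    have hn : ((n : ℂ) + 1) ≠ 0 := by exact_mod_cast n.succ_ne_zero
    have hnR : (0 : ℝ) < (n : ℝ) + 1 := by positivity
    have hb := eq_sub_of_add_eq' h
    have hterm : ∀ i ∈ Finset.range n, ‖((n + 1).choose (n - 1 - i) : ℂ) *
        Polynomial.aeval a (Polynomial.bernoulli (n - 1 - i))‖ ≤
        ((n : ℝ) + 1) * n.factorial * T ^ n * (1 / 2) ^ (i + 1) := by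
      intro i hi
      have hi' : i < n := Finset.mem_range.1 hi
      obtain ⟨l, rfl⟩ : ∃ l, n = l + i + 1 := ⟨n - 1 - i, by omega⟩
      have e : l + i + 1 - 1 - i = l := by omega
      rw [e, norm_mul, Complex.norm_natCast]
      have h1 := ih l (by omega)
      have hc : ((l + i + 1 + 1).choose l : ℝ) * l.factorial * 2 ≤ (l + i + 1 + 1).factorial := by
        have := Nat.choose_mul_factorial_mul_factorial (show l ≤ l + i + 1 + 1 by omega)
        have e2 : l + i + 1 + 1 - l = i + 2 := by omega
        rw [e2] at this
        have h2 : 2 ≤ (i + 2).factorial := (Nat.self_le_factorial (i + 2)).trans' (by omega)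
        have : (l + i + 1 + 1).choose l * l.factorial * 2 ≤ (l + i + 1 + 1).factorial := by
          rw [← this]; exact Nat.mul_le_mul_left _ h2
        exact_mod_cast this
      have hp : T ^ l ≤ T ^ (l + i + 1) * (1 / 2) ^ (i + 1) := by
        rw [add_assoc, pow_add, mul_assoc, ← mul_pow]
        exact le_mul_of_one_le_right (by positivity) (one_le_pow₀ (by linarith))
      have hf : (((l + i + 1 : ℕ) : ℝ) + 1) * (l + i + 1).factorial =
          (l + i + 1 + 1).factorial := by
        rw [Nat.factorial_succ (l + i + 1)]; push_cast; ring
      rw [hf]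
      calc _ ≤ ((l + i + 1 + 1).choose l : ℝ) * (2 * T ^ l * l.factorial) := by gcongr
        _ = (((l + i + 1 + 1).choose l : ℝ) * l.factorial * 2) * T ^ l := by ring
        _ ≤ ((l + i + 1 + 1).factorial) * (T ^ (l + i + 1) * (1 / 2) ^ (i + 1)) := by gcongr
        _ = _ := by ring
    have hsum : ‖∑ i ∈ Finset.range n, ((n + 1).choose (n - 1 - i) : ℂ) *
        Polynomial.aeval a (Polynomial.bernoulli (n - 1 - i))‖ ≤
        ((n : ℝ) + 1) * n.factorial * T ^ n := by
      refine (norm_sum_le_of_le _ hterm).trans ?_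
      rw [← Finset.mul_sum]
      refine mul_le_of_le_one_right (by positivity) ?_
      have : ∑ i ∈ Finset.range n, (1 / 2 : ℝ) ^ (i + 1) = 1 - (1 / 2) ^ n := by
        clear * -
        induction n with
        | zero => simp
        | succ n ih => rw [Finset.sum_range_succ, ih]; ring
      rw [this]
      have : (0 : ℝ) < (1 / 2) ^ n := by positivity
      linarith
    have hfact : (1 : ℝ) ≤ n.factorial := by exact_mod_cast n.factorial_pos
    have ha : ‖a‖ ^ n ≤ T ^ n * n.factorial :=
      (pow_le_pow_left₀ (norm_nonneg a) (by linarith) n).trans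
        (le_mul_of_one_le_right (by positivity) hfact)
    have hfin : ((n : ℝ) + 1) * ‖Polynomial.aeval a (Polynomial.bernoulli n)‖ ≤
        ((n : ℝ) + 1) * (2 * T ^ n * n.factorial) := by
      have e : ‖(n : ℂ) + 1‖ = (n : ℝ) + 1 := by exact_mod_cast Complex.norm_natCast (n + 1)
      calc _ = ‖((n : ℂ) + 1) * Polynomial.aeval a (Polynomial.bernoulli n)‖ := by rw [norm_mul, e]
        _ ≤ ‖((n : ℂ) + 1) * a ^ n‖ + _ := by rw [hb]; exact norm_sub_le _ _
        _ ≤ ((n : ℝ) + 1) * (T ^ n * n.factorial) + ((n : ℝ) + 1) * n.factorial * T ^ n := by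
          rw [norm_mul, e, norm_pow]; gcongr
        _ = _ := by ring
    exact le_of_mul_le_mul_left hfin hnR

theorem norm_coeff_le (a : ℂ) (m : ℕ) :
    ‖coeff a m‖ ≤ 2 * (2 + ‖a‖) ^ (m + 1) * m.factorial := by
  rcases Nat.eq_zero_or_pos m with rfl | hm
  · rw [coeff_zero, norm_zero]; positivity
  have hm1 : (1 : ℝ) ≤ m := by exact_mod_cast hm
  have e : ‖(m : ℂ) + 1‖ = (m : ℝ) + 1 := by exact_mod_cast Complex.norm_natCast (m + 1)
  have h := norm_aeval_bernoulli_le a (m + 1)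
  rw [coeff, norm_mul, norm_div, norm_pow, norm_neg, norm_one, one_pow, norm_mul, e,
    Complex.norm_natCast]
  rw [Nat.factorial_succ] at h
  push_cast at h
  rw [one_div, inv_mul_le_iff₀ (by positivity)]
  refine h.trans ?_
  have : 0 ≤ 2 * (2 + ‖a‖) ^ (m + 1) * (m.factorial : ℝ) * (m + 1) := by positivity
  nlinarith

theorem norm_powDiffCoeff_le (m j : ℕ) : ‖powDiffCoeff m j‖ ≤ 2 ^ j := by
  unfold powDiffCoeff
  split_ifs with h
  · rw [norm_mul, norm_neg, norm_pow, norm_neg, norm_one, one_pow, one_mul, Complex.norm_natCast]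
    have : (j - 1).choose (j - m) ≤ 2 ^ j :=
      (Nat.choose_le_two_pow _ _).trans (Nat.pow_le_pow_right (by norm_num) (by omega))
    exact_mod_cast this
  · rw [norm_zero]; positivity

theorem norm_stepCoeff_le (a : ℂ) (j : ℕ) : ‖stepCoeff a j‖ ≤ 4 * (2 + ‖a‖) ^ j := by
  unfold stepCoeff
  split_ifs with h
  · rw [norm_zero]; positivity
  have hj : (1 : ℝ) ≤ j := by exact_mod_cast Nat.one_le_iff_ne_zero.2 h
  have ha := norm_nonneg a
  have e : ‖(j : ℂ) + 1‖ = (j : ℝ) + 1 := by exact_mod_cast Complex.norm_natCast (j + 1)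
  have h1 : ‖a ^ j / (j : ℂ)‖ ≤ (2 + ‖a‖) ^ j := by
    rw [norm_div, norm_pow, Complex.norm_natCast]
    exact (div_le_self (by positivity) hj).trans (pow_le_pow_left₀ ha (by linarith) _)
  have h2 : ‖1 / ((j : ℂ) + 1)‖ ≤ 1 := by
    rw [norm_div, norm_one, e]
    exact div_le_self zero_le_one (by linarith)
  have h3 : ‖(a + 1 / 2) / (j : ℂ)‖ ≤ 2 + ‖a‖ := by
    rw [norm_div, Complex.norm_natCast]
    refine (div_le_self (norm_nonneg _) hj).trans ((norm_add_le _ _).trans ?_)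
    norm_num
    linarith
  have h4 : 2 + ‖a‖ ≤ (2 + ‖a‖) ^ j := le_self_pow₀ (by linarith) h
  rw [norm_mul, norm_pow, norm_neg, norm_one, one_pow, one_mul]
  have := norm_sub_le (a ^ j / (j : ℂ) + 1 / ((j : ℂ) + 1)) ((a + 1 / 2) / (j : ℂ))
  have := norm_add_le (a ^ j / (j : ℂ)) (1 / ((j : ℂ) + 1))
  linarith

theorem hasSum_powDiffCoeff {w : ℂ} (hw : ‖w‖ < 1) (m : ℕ) :
    HasSum (fun j => powDiffCoeff (m + 1) j * w ^ j) (w ^ (m + 1) - (w / (1 + w)) ^ (m + 1)) := by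
  have hw1 : 1 + w ≠ 0 := by
    intro h
    rw [add_eq_zero_iff_eq_neg'.1 h, norm_neg, norm_one] at hw
    exact lt_irrefl _ hw
  have h := hasSum_choose_mul_geometric_of_norm_lt_one m (r := -w) (by rwa [norm_neg])
  rw [← hasSum_nat_add_iff' 1] at h
  rw [← hasSum_nat_add_iff' (m + 2)]
  have h0 : ∑ i ∈ Finset.range (m + 2), powDiffCoeff (m + 1) i * w ^ i = 0 :=
    Finset.sum_eq_zero fun i hi => by
      rw [powDiffCoeff, if_neg (by have := Finset.mem_range.1 hi; omega), zero_mul]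
  rw [h0, sub_zero]
  refine hasSum_of_eq (h.mul_left (-w ^ (m + 1))) (fun n => ?_) ?_
  · rw [powDiffCoeff, if_pos (by omega), show n + (m + 2) - (m + 1) = n + 1 by omega,
      show n + (m + 2) - 1 = n + 1 + m by omega, Nat.choose_symm_add, neg_pow w]
    ring
  · simp only [Finset.sum_range_one, zero_add, Nat.choose_self, Nat.cast_one, pow_zero, mul_one,
      sub_neg_eq_add, div_pow]
    ring

theorem hasSum_coeff_mul_powDiffCoeff (a : ℂ) {w : ℂ} (hw : ‖w‖ < 1) (m : ℕ) :
    HasSum (fun j => coeff a m * powDiffCoeff m j * w ^ j)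
      (coeff a m * (w ^ m - (w / (1 + w)) ^ m)) := by
  rcases m with _ | m
  · simp [coeff_zero, hasSum_zero]
  · simpa only [mul_assoc] using (hasSum_powDiffCoeff hw m).mul_left (coeff a (m + 1))

theorem hasSum_stepCoeff (a : ℂ) {w : ℂ} (hw0 : w ≠ 0) (hw : ‖w‖ < 1) (haw : ‖a * w‖ < 1) :
    HasSum (fun j => stepCoeff a j * w ^ j) (step a w) := by
  have h1 := Complex.hasSum_taylorSeries_log hw
  have h2 := Complex.hasSum_taylorSeries_log haw
  have h3 : HasSum (fun j : ℕ => (-1) ^ j * w ^ j / ((j : ℂ) + 1)) (1 / w * Complex.log (1 + w)) := by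
    have := (hasSum_nat_add_iff' 1).2 h1
    simp only [Finset.sum_range_one, Nat.cast_zero, div_zero, sub_zero] at this
    refine hasSum_of_eq (this.mul_left (1 / w)) (fun j => ?_) rfl
    push_cast
    field_simp
    ring
  have h4 : HasSum (fun j : ℕ => if j = 0 then (1 : ℂ) else 0) 1 := hasSum_ite_eq 0 1
  refine hasSum_of_eq (((h3.add (h1.mul_left (a + 1 / 2))).sub h4).sub h2) (fun j => ?_) ?_
  · rcases j with _ | j
    · simp [stepCoeff]
    · simp only [stepCoeff, Nat.succ_ne_zero, if_false, mul_pow, pow_succ (-1 : ℂ) (j + 1)]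
      ring
  · rw [step]; ring

/-- After subtraction of the first terms of the expansion, `step a w` is `O(w^(n+1))`, with a
constant of factorial growth in `n`. -/
theorem norm_step_sub_sum_le (a : ℂ) {w : ℂ} (hw0 : w ≠ 0) (hw : (2 + ‖a‖) * ‖w‖ ≤ 1 / 2)
    (n : ℕ) :
    ‖step a w - ∑ m ∈ Finset.range n, coeff a m * (w ^ m - (w / (1 + w)) ^ m)‖ ≤
      12 * (2 + ‖a‖) ^ (2 * n + 1) * n.factorial * ‖w‖ ^ (n + 1) := by
  set T := 2 + ‖a‖ with hT
  have ha := norm_nonneg a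
  have hT2 : 2 ≤ T := by linarith
  have hw' := norm_nonneg w
  have hw1 : ‖w‖ < 1 := by nlinarith
  have haw : ‖a * w‖ < 1 := by rw [norm_mul]; nlinarith
  have hS := (hasSum_stepCoeff a hw0 hw1 haw).sub
    (hasSum_sum (s := Finset.range n) fun m _ => hasSum_coeff_mul_powDiffCoeff a hw1 m)
  set e : ℕ → ℂ := fun j => stepCoeff a j - ∑ m ∈ Finset.range n, coeff a m * powDiffCoeff m j
    with he
  have hS' : HasSum (fun j => e j * w ^ j)
      (step a w - ∑ m ∈ Finset.range n, coeff a m * (w ^ m - (w / (1 + w)) ^ m)) := by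
    refine hasSum_of_eq hS (fun j => ?_) rfl
    rw [he, sub_mul, Finset.sum_mul]
  -- By the formal identity, the coefficients up to degree `n` cancel.
  have hlow : ∀ j ≤ n, e j = 0 := by
    intro j hj
    rw [he]
    simp only
    rw [stepCoeff_eq_sum, sub_eq_zero]
    refine Finset.sum_subset (Finset.range_mono hj) fun m _ hm => ?_
    rw [powDiffCoeff, if_neg (by simpa using hm), mul_zero]
  have hbound : ∀ j, ‖e j‖ ≤ 6 * T ^ n * n.factorial * T ^ j := by
    intro j
    have hf : (1 : ℝ) ≤ n.factorial := by exact_mod_cast n.factorial_pos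
    have hTn : 1 ≤ T ^ n := one_le_pow₀ (by linarith)
    have h1 : ‖stepCoeff a j‖ ≤ 4 * T ^ n * n.factorial * T ^ j := by
      refine (norm_stepCoeff_le a j).trans ?_
      gcongr
      nlinarith
    -- Each of the `n` terms is at most a multiple of `(n-1)!`, and `n (n-1)! = n!`.
    have h2 : ‖∑ m ∈ Finset.range n, coeff a m * powDiffCoeff m j‖ ≤
        2 * T ^ n * n.factorial * T ^ j := by
      have hm : ∀ m ∈ Finset.range n, ‖coeff a m * powDiffCoeff m j‖ ≤
          2 * T ^ n * (n - 1).factorial * T ^ j := by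
        intro m hm
        have hm' := Finset.mem_range.1 hm
        rw [norm_mul]
        refine mul_le_mul ?_ ?_ (norm_nonneg _) (by positivity)
        · refine (norm_coeff_le a m).trans ?_
          gcongr
          · linarith
          · omega
          · omega
        · exact (norm_powDiffCoeff_le m j).trans (by gcongr)
      rcases Nat.eq_zero_or_pos n with hn | hn
      · rw [hn, Finset.sum_range_zero, norm_zero]; positivity
      · refine (norm_sum_le_of_le _ hm).trans (le_of_eq ?_)
        rw [Finset.sum_const, Finset.card_range, nsmul_eq_mul]
        obtain ⟨n, rfl⟩ := Nat.exists_eq_add_of_le' hn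
        rw [Nat.add_sub_cancel, Nat.factorial_succ]; push_cast; ring
    refine (norm_sub_le _ _).trans ?_
    linarith
  have hlow0 : ∑ j ∈ Finset.range (n + 1), e j * w ^ j = 0 := Finset.sum_eq_zero fun j hj => by
    rw [hlow j (by have := Finset.mem_range.1 hj; omega), zero_mul]
  rw [← hasSum_nat_add_iff' (n + 1), hlow0, sub_zero] at hS'
  clear_value T
  have hg : HasSum (fun k : ℕ => 6 * T ^ n * n.factorial * (T * ‖w‖) ^ (n + 1) * (1 / 2) ^ k)
      (6 * T ^ n * n.factorial * (T * ‖w‖) ^ (n + 1) * 2) := by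
    have := hasSum_geometric_two.mul_left (6 * T ^ n * n.factorial * (T * ‖w‖) ^ (n + 1))
    exact this
  refine (hS'.norm_le_of_bounded hg fun k => ?_).trans (le_of_eq ?_)
  · rw [norm_mul, norm_pow]
    calc _ ≤ 6 * T ^ n * n.factorial * T ^ (k + (n + 1)) * ‖w‖ ^ (k + (n + 1)) := by
          gcongr; exact hbound _
      _ = 6 * T ^ n * n.factorial * (T * ‖w‖) ^ (n + 1) * (T * ‖w‖) ^ k := by ring
      _ ≤ _ := by gcongr
  · ring

end ShiftedStirling

/-! ### Summing the decrements over `z, z + 1, z + 2, …` -/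

namespace ShiftedStirling

open scoped Topology

/-- The points whose translates by `t ≥ 0` satisfy `c (|z| + t) ≤ |z + t|`. For small `c > 0` it
contains any given sector `|arg z| < π - δ`; it is invariant under positive scaling. -/
def cone (c : ℝ) : Set ℂ := {z : ℂ | ∀ t : ℝ, 0 ≤ t → c * (‖z‖ + t) ≤ ‖z + t‖}

/-- The remainder `J_a(z)` in `log Γ(z+a) = ½ log 2π + (z+a-½) log z - z + J_a(z)`, the sum of the
decrements `step a (1/(z+k))`. -/
def remainder (a z : ℂ) : ℂ := ∑' k : ℕ, step a (1 / (z + k))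

/-- The expansion `f ∼ ∑ α_k z^{-k}` holds at infinity in `cone c` with remainders
`M τⁿ n! / |z|ⁿ`. -/
def GevreyBound (c : ℝ) (f : ℂ → ℂ) (α : ℕ → ℂ) : Prop :=
  ∃ R M τ : ℝ, 0 < R ∧ 0 < M ∧ 0 < τ ∧ ∀ z ∈ cone c, R ≤ ‖z‖ → ∀ n : ℕ, 1 ≤ n →
    ‖f z - ∑ k ∈ Finset.range n, α k / z ^ k‖ ≤ M * τ ^ n * (n.factorial : ℝ) / ‖z‖ ^ n

/-- Comparison with the telescoping series of `1/(x+k) - 1/(x+k+1) ≥ 1/(2 (x+k)²)`. -/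
theorem sum_one_div_add_pow_le {x : ℝ} (hx : 1 ≤ x) (n N : ℕ) :
    ∑ k ∈ Finset.range N, 1 / (x + k) ^ (n + 2) ≤ 2 / x ^ (n + 1) := by
  have hx0 : 0 < x := by linarith
  have key : ∑ k ∈ Finset.range N, 1 / (x + k) ^ (n + 2) ≤
      2 / x ^ n * (1 / x - 1 / (x + N)) := by
    induction N with
    | zero => simp
    | succ N ih =>
      rw [Finset.sum_range_succ]
      have hN : (0 : ℝ) ≤ N := N.cast_nonneg
      have h1 : 1 / (x + N) ^ (n + 2) ≤ 2 / x ^ n * (1 / (x + N) - 1 / (x + (N + 1 : ℕ))) := by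
        have e : 1 / (x + N) - 1 / (x + (N + 1 : ℕ)) = 1 / ((x + N) * (x + N + 1)) := by
          push_cast
          have : x + N ≠ 0 := by positivity
          have : x + N + 1 ≠ 0 := by positivity
          have : x + (N + 1) ≠ 0 := by positivity
          field_simp
          ring
        rw [e, div_mul_div_comm, mul_one, div_le_div_iff₀ (by positivity) (by positivity), one_mul]
        have : x ^ n ≤ (x + N) ^ n := pow_le_pow_left₀ hx0.le (by linarith) n
        calc x ^ n * ((x + N) * (x + N + 1)) ≤ (x + N) ^ n * ((x + N) * (2 * (x + N))) := by
              gcongr; linarith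
          _ = _ := by ring
      calc _ ≤ 2 / x ^ n * (1 / x - 1 / (x + N)) +
            2 / x ^ n * (1 / (x + N) - 1 / (x + (N + 1 : ℕ))) := add_le_add ih h1
        _ = _ := by ring
  refine key.trans ?_
  have : (0 : ℝ) ≤ 1 / (x + N) := by positivity
  calc _ ≤ 2 / x ^ n * (1 / x) := by gcongr; linarith
    _ = _ := by rw [pow_succ]; field_simp

theorem le_norm_add_natCast {c : ℝ} {z : ℂ} (hz : z ∈ cone c) (k : ℕ) :
    c * (‖z‖ + k) ≤ ‖z + k‖ := by
  simpa using hz k k.cast_nonneg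

theorem norm_step_natCast_sub_sum_le {a z : ℂ} {c : ℝ} (hc : 0 < c) (hz : z ∈ cone c)
    (hR : 2 * (2 + ‖a‖) / c ≤ ‖z‖) (n k : ℕ) :
    ‖step a (1 / (z + k)) -
        ∑ m ∈ Finset.range n, coeff a m * (1 / (z + k) ^ m - 1 / (z + (k + 1 : ℕ)) ^ m)‖ ≤
      12 * (2 + ‖a‖) ^ (2 * n + 1) * n.factorial / c ^ (n + 1) * (1 / (‖z‖ + k) ^ (n + 1)) := by
  have ha := norm_nonneg a
  have hzpos : 0 < ‖z‖ := lt_of_lt_of_le (by positivity) hR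
  have hk := le_norm_add_natCast hz k
  have hk0 : (0 : ℝ) ≤ k := k.cast_nonneg
  have hlow : 0 < c * (‖z‖ + k) := by positivity
  have hpos : 0 < ‖z + k‖ := hlow.trans_le hk
  have hne : z + k ≠ 0 := norm_pos_iff.1 hpos
  -- All the points `1/(z+k)` lie in the disc where the bound for `step a` holds.
  have hbig : 2 * (2 + ‖a‖) ≤ ‖z + k‖ := by
    rw [div_le_iff₀ hc] at hR
    refine le_trans ?_ hk
    nlinarith
  have h := norm_step_sub_sum_le a (one_div_ne_zero hne) (by
    rw [norm_div, norm_one, mul_one_div, div_le_iff₀ hpos]; linarith) n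
  have e : ∀ m, (1 / (z + k) / (1 + 1 / (z + k))) ^ m = 1 / (z + (k + 1 : ℕ)) ^ m := by
    intro m
    have : 1 / (z + k) / (1 + 1 / (z + k)) = 1 / (z + (k + 1 : ℕ)) := by
      rw [div_div, mul_add, mul_one, mul_one_div_cancel hne]
      push_cast
      ring
    rw [this, div_pow, one_pow]
  simp only [e, div_pow, one_pow] at h
  refine h.trans ?_
  rw [norm_div, norm_one, div_pow, one_pow, div_mul_eq_mul_div, mul_div_assoc]
  have : 1 / ‖z + k‖ ^ (n + 1) ≤ 1 / (‖z‖ + k) ^ (n + 1) / c ^ (n + 1) := by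
    rw [div_div, ← mul_pow, mul_comm _ c]
    exact one_div_le_one_div_of_le (by positivity) (pow_le_pow_left₀ hlow.le hk _)
  exact mul_le_mul_of_nonneg_left this (by positivity)

theorem summable_step {a z : ℂ} {c : ℝ} (hc : 0 < c) (hz : z ∈ cone c)
    (hR : 2 * (2 + ‖a‖) / c ≤ ‖z‖) (hz1 : 1 ≤ ‖z‖) :
    Summable fun k : ℕ => step a (1 / (z + k)) := by
  have hs : Summable fun k : ℕ => 1 / (‖z‖ + k) ^ (0 + 2) :=
    summable_of_sum_range_le (fun k => by positivity) fun N => sum_one_div_add_pow_le hz1 0 N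
  refine Summable.of_norm_bounded (hs.mul_left (12 * (2 + ‖a‖) ^ (2 * 1 + 1) *
    (1 : ℕ).factorial / c ^ (1 + 1))) fun k => ?_
  simpa [coeff_zero] using norm_step_natCast_sub_sum_le hc hz hR 1 k

/-- The Stirling series with shift `a`, with Gevrey bounds for the remainders. -/
theorem gevreyBound_remainder (a : ℂ) {c : ℝ} (hc : 0 < c) :
    GevreyBound c (remainder a) (coeff a) := by
  have ha := norm_nonneg a
  refine ⟨max 1 (2 * (2 + ‖a‖) / c), 24 * (2 + ‖a‖) / c, (2 + ‖a‖) ^ 2 / c, by positivity,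
    by positivity, by positivity, fun z hz hR n hn => ?_⟩
  have hz1 := (le_max_left _ _).trans hR
  have hR := (le_max_right _ _).trans hR
  obtain ⟨n, rfl⟩ := Nat.exists_eq_add_of_le' hn
  have hlim1 := (summable_step hc hz hR hz1).hasSum.tendsto_sum_nat
  have hz0 : 0 < ‖z‖ := by linarith
  have hinf : Tendsto (fun N : ℕ => ‖z + N‖) atTop atTop := by
    refine tendsto_atTop_mono (le_norm_add_natCast hz) ?_
    exact (tendsto_atTop_add_const_left _ _ tendsto_natCast_atTop_atTop).const_mul_atTop hc
  have hlim2 : Tendsto (fun N : ℕ => ∑ m ∈ Finset.range (n + 1),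
      coeff a m * (1 / z ^ m - 1 / (z + N) ^ m)) atTop
      (𝓝 (∑ m ∈ Finset.range (n + 1), coeff a m / z ^ m)) := by
    refine tendsto_finsetSum _ fun m _ => ?_
    rcases m with _ | m
    · simp [coeff_zero]
    · have h0 : Tendsto (fun N : ℕ => 1 / (z + N) ^ (m + 1)) atTop (𝓝 0) := by
        rw [tendsto_zero_iff_norm_tendsto_zero]
        simp only [one_div, norm_inv, norm_pow]
        exact ((tendsto_pow_atTop m.succ_ne_zero).comp hinf).inv_tendsto_atTop
      have := (h0.const_sub (1 / z ^ (m + 1))).const_mul (coeff a (m + 1))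
      rwa [sub_zero, mul_one_div] at this
  refine le_of_tendsto (hlim1.sub hlim2).norm (Eventually.of_forall fun N => ?_)
  -- The bound is proved for partial sums, where the subtracted terms telescope.
  have e : ∑ k ∈ Finset.range N, step a (1 / (z + k)) -
      ∑ m ∈ Finset.range (n + 1), coeff a m * (1 / z ^ m - 1 / (z + N) ^ m) =
      ∑ k ∈ Finset.range N, (step a (1 / (z + k)) - ∑ m ∈ Finset.range (n + 1),
        coeff a m * (1 / (z + k) ^ m - 1 / (z + (k + 1 : ℕ)) ^ m)) := by
    rw [Finset.sum_sub_distrib, Finset.sum_comm]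
    congr 1
    refine Finset.sum_congr rfl fun m _ => ?_
    rw [← Finset.mul_sum, Finset.sum_range_sub' (fun k : ℕ => 1 / (z + k) ^ m), Nat.cast_zero,
      add_zero]
  rw [e]
  refine (norm_sum_le_of_le _ fun k _ => norm_step_natCast_sub_sum_le hc hz hR (n + 1) k).trans ?_
  rw [← Finset.mul_sum]
  refine (mul_le_mul_of_nonneg_left (sum_one_div_add_pow_le hz1 n N) (by positivity)).trans
    (le_of_eq ?_)
  have hz0' := hz0.ne'
  have hc' := hc.ne'
  rw [div_pow, ← pow_mul]
  field_simp
  ring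

/-! ### Stirling's formula for `Γ(z + a)` -/

theorem cone_subset_slitPlane {c : ℝ} (hc : 0 < c) {z : ℂ} (hz : z ∈ cone c) (h0 : z ≠ 0) :
    z ∈ Complex.slitPlane := by
  rw [Complex.mem_slitPlane_iff]
  by_contra! h
  have hre : z = (z.re : ℂ) := Complex.ext rfl (by simp [h.2])
  have h1 := hz (-z.re) (by linarith [h.1])
  have e : z + ((-z.re : ℝ) : ℂ) = 0 := by
    rw [Complex.ofReal_neg, ← hre, add_neg_cancel]
  rw [e, norm_zero] at h1
  have : 0 < c * (‖z‖ + -z.re) := by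
    have := norm_pos_iff.2 h0
    have := h.1
    apply mul_pos hc
    linarith
  linarith

theorem log_add_one {s : ℂ} (hs : s ∈ Complex.slitPlane) (h1 : s + 1 ≠ 0) :
    Complex.log (s + 1) = Complex.log s + Complex.log (1 + 1 / s) := by
  have hs0 := Complex.slitPlane_ne_zero hs
  have e : s + 1 = s * (1 + 1 / s) := by field_simp
  have hne : 1 + 1 / s ≠ 0 := fun h => h1 (by rw [e, h, mul_zero])
  rw [e, Complex.log_mul hs0 hne]
  have hpos : 0 < Complex.normSq s := Complex.normSq_pos.2 hs0
  have him : (1 + 1 / s).im = -s.im / Complex.normSq s := by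
    simp [Complex.inv_im]
  have b1 := Complex.neg_pi_lt_arg s
  have b2 := Complex.arg_le_pi s
  have b3 := Complex.neg_pi_lt_arg (1 + 1 / s)
  have b4 := Complex.arg_le_pi (1 + 1 / s)
  -- `s` and `1 + 1/s` lie on opposite sides of the real axis, so their arguments cannot add up to
  -- more than `π` in absolute value.
  rcases lt_trichotomy s.im 0 with h | h | h
  · have h2 : 0 ≤ (1 + 1 / s).arg := by
      rw [Complex.arg_nonneg_iff, him]
      exact div_nonneg (by linarith) hpos.le
    have h3 := Complex.arg_neg_iff.2 h
    constructor <;> linarith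
  · have hre : 0 < s.re := by
      rcases Complex.mem_slitPlane_iff.1 hs with h' | h'
      · exact h'
      · exact absurd h h'
    have h2 : s.arg = 0 := Complex.arg_eq_zero_iff.2 ⟨hre.le, h⟩
    rw [h2, zero_add]
    exact Complex.arg_mem_Ioc _
  · have h2 : (1 + 1 / s).arg < 0 := by
      rw [Complex.arg_neg_iff, him]
      exact div_neg_of_neg_of_pos (by linarith) hpos
    have h3 := Complex.arg_nonneg_iff.2 h.le
    constructor <;> linarith

/-- The elementary part of Stirling's formula for `log Γ(z + a)`, without the constant. -/
def mainPart (a z : ℂ) : ℂ := (z + a - 1 / 2) * Complex.log z - z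

theorem exp_step {a s : ℂ} (hs : s ∈ Complex.slitPlane) (h1 : s + 1 ≠ 0) (ha : s + a ≠ 0) :
    Complex.exp (step a (1 / s)) * (s + a) =
      Complex.exp (mainPart a (s + 1) - mainPart a s) := by
  have hs0 := Complex.slitPlane_ne_zero hs
  have hne : 1 + a * (1 / s) ≠ 0 := by
    intro h
    apply ha
    have : s + a = s * (1 + a * (1 / s)) := by field_simp
    rw [this, h, mul_zero]
  have e : step a (1 / s) = mainPart a (s + 1) - mainPart a s - Complex.log s -
      Complex.log (1 + a * (1 / s)) := by
    rw [step, mainPart, mainPart, log_add_one hs h1, one_div_one_div]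
    ring
  rw [e, Complex.exp_sub, Complex.exp_sub, Complex.exp_log hs0, Complex.exp_log hne]
  field_simp

theorem exp_sum_step {a z : ℂ} (hs : ∀ k : ℕ, z + k ∈ Complex.slitPlane)
    (ha : ∀ k : ℕ, z + k + a ≠ 0) (N : ℕ) :
    Complex.exp (∑ k ∈ Finset.range N, step a (1 / (z + k))) *
        ∏ k ∈ Finset.range N, (z + a + k) = Complex.exp (mainPart a (z + N) - mainPart a z) := by
  have h : ∀ k ∈ Finset.range N, Complex.exp (step a (1 / (z + k))) * (z + a + k) =
      Complex.exp (mainPart a (z + (k + 1 : ℕ)) - mainPart a (z + k)) := by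
    intro k _
    have h1 : z + k + 1 ≠ 0 := by
      have := Complex.slitPlane_ne_zero (hs (k + 1))
      push_cast at this
      rwa [← add_assoc] at this
    rw [add_right_comm z a, exp_step (hs k) h1 (ha k)]
    push_cast
    rw [add_assoc]
  rw [Complex.exp_sum, ← Finset.prod_mul_distrib, Finset.prod_congr rfl h, ← Complex.exp_sum,
    Finset.sum_range_sub (fun k : ℕ => mainPart a (z + k)), Nat.cast_zero, add_zero]

/-- The constant `√(2π)`, from Stirling's formula for `n!`. -/
theorem tendsto_exp_mainPart_div (a z : ℂ) (hz : ∀ k : ℕ, z + k ≠ 0) :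
    Tendsto (fun n : ℕ => Complex.exp (mainPart a (z + (n + 1 : ℕ))) /
      ((n : ℂ) ^ (z + a) * n.factorial)) atTop (𝓝 (1 / (√(2 * Real.pi) : ℝ))) := by
  have hS : Tendsto (fun n : ℕ => (((√2 * Stirling.stirlingSeq n)⁻¹ : ℝ) : ℂ)) atTop
      (𝓝 (1 / (√(2 * Real.pi) : ℝ))) := by
    have h := (Stirling.tendsto_stirlingSeq_sqrt_pi.const_mul √2).inv₀ (by positivity)
    rw [← Real.sqrt_mul (by norm_num)] at h
    have := (Complex.continuous_ofReal.tendsto _).comp h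
    rw [one_div, ← Complex.ofReal_inv]
    exact this
  have hlog : Tendsto (fun n : ℕ => (n : ℂ) * Complex.log (1 + (z + 1) / n)) atTop
      (𝓝 (z + 1)) := by
    refine Complex.tendsto_nat_mul_log_one_add_of_tendsto (tendsto_const_nhds.congr' ?_)
    filter_upwards [eventually_ne_atTop 0] with n hn
    have : (n : ℂ) ≠ 0 := by exact_mod_cast hn
    field_simp
  have hinv : Tendsto (fun n : ℕ => 1 / (n : ℂ)) atTop (𝓝 0) :=
    tendsto_one_div_atTop_nhds_zero_nat
  have hE : Tendsto (fun n : ℕ => Complex.exp ((n + (z + a + 1 / 2)) *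
      Complex.log (1 + (z + 1) / n) - (z + 1))) atTop (𝓝 1) := by
    have h := (((hinv.const_mul (z + a + 1 / 2)).const_add 1).mul hlog).sub_const (z + 1)
    rw [mul_zero, add_zero, one_mul, sub_self] at h
    have h' := (Complex.continuous_exp.tendsto _).comp h
    rw [Complex.exp_zero] at h'
    refine h'.congr' ?_
    filter_upwards [eventually_ne_atTop 0] with n hn
    have : (n : ℂ) ≠ 0 := by exact_mod_cast hn
    simp only [Function.comp]
    congr 1
    field_simp
  have hmul := hS.mul hE
  rw [mul_one] at hmul
  refine hmul.congr' ?_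
  filter_upwards [eventually_ne_atTop 0] with n hn
  have hnC : (n : ℂ) ≠ 0 := by exact_mod_cast hn
  have hnR : (0 : ℝ) < n := by positivity
  have hq : (√2 * Stirling.stirlingSeq n)⁻¹ =
      (n : ℝ) ^ n * √n * Real.exp (-n) / n.factorial := by
    rw [Stirling.stirlingSeq, Real.sqrt_mul (by norm_num), div_pow, ← Real.exp_nat_mul, mul_one,
      Real.exp_neg]
    have h2 : √2 * √2 = (2 : ℝ) := Real.mul_self_sqrt (by norm_num)
    have := Real.exp_pos (n : ℝ)
    field_simp
  have hzn : z + (n + 1 : ℕ) = ((n : ℝ) : ℂ) * (1 + (z + 1) / n) := by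
    push_cast
    field_simp
    ring
  have hne : 1 + (z + 1) / n ≠ 0 := fun h => hz (n + 1) (by rw [hzn, h, mul_zero])
  have hlogn : Complex.exp (Real.log n : ℂ) = n := by
    rw [← Complex.ofReal_exp, Real.exp_log hnR]; simp
  have hM : mainPart a (z + (n + 1 : ℕ)) = ((n : ℂ) * (Real.log n : ℂ) +
      (((1 / 2 * Real.log n : ℝ) : ℂ) + (Complex.log n * (z + a)))) + ((-n : ℝ) : ℂ) +
      ((n + (z + a + 1 / 2)) * Complex.log (1 + (z + 1) / n) - (z + 1)) := by
    rw [mainPart, show Complex.log (z + (n + 1 : ℕ)) = _ by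
      rw [hzn, Complex.log_ofReal_mul hnR hne], ← Complex.natCast_log]
    push_cast
    ring
  have hsq : Complex.exp ((1 / 2 * Real.log n : ℝ) : ℂ) = (√n : ℝ) := by
    rw [← Complex.ofReal_exp, Real.sqrt_eq_rpow, Real.rpow_def_of_pos hnR, mul_comm]
  rw [hM, Complex.exp_add, Complex.exp_add, Complex.exp_add, Complex.exp_add, Complex.exp_nat_mul,
    hlogn, hsq, ← Complex.cpow_def_of_ne_zero hnC, ← Complex.ofReal_exp, hq]
  have hcp : (n : ℂ) ^ (z + a) ≠ 0 := by simp [Complex.cpow_eq_zero_iff, hnC]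
  have hfac : (n.factorial : ℂ) ≠ 0 := by exact_mod_cast n.factorial_ne_zero
  push_cast
  field_simp

/-- Stirling's formula with shift `a` and an exact remainder. Telescoping `exp (step a (1/(z+k)))`
turns the sum defining `remainder a z` into Gauss's product for `Γ(z + a)`. -/
theorem Gamma_add_eq_exp {a z : ℂ} {c : ℝ} (hc : 0 < c) (hz : z ∈ cone c)
    (hR : 2 * (2 + ‖a‖) / c ≤ ‖z‖) (hz1 : 1 ≤ ‖z‖) :
    Complex.Gamma (z + a) =
      Complex.exp (((1 / 2 * Real.log (2 * Real.pi) : ℝ) : ℂ) + mainPart a z + remainder a z) := by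
  have hbig : ∀ k : ℕ, 2 * (2 + ‖a‖) ≤ ‖z + k‖ := fun k => by
    rw [div_le_iff₀ hc] at hR
    refine le_trans ?_ (le_norm_add_natCast hz k)
    have : (0 : ℝ) ≤ c * k := by positivity
    nlinarith
  have hapos := norm_nonneg a
  have hne : ∀ k : ℕ, z + k ≠ 0 := fun k => norm_pos_iff.1 (by linarith [hbig k])
  have hcone : ∀ k : ℕ, z + k ∈ Complex.slitPlane := by
    intro k
    refine Complex.mem_slitPlane_iff.2 ?_
    have hzs := cone_subset_slitPlane hc hz (by simpa using hne 0)
    rcases Complex.mem_slitPlane_iff.1 hzs with h | h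
    · left
      have : (0 : ℝ) ≤ k := k.cast_nonneg
      simp
      linarith
    · right
      simpa using h
  have ha : ∀ k : ℕ, z + k + a ≠ 0 := fun k h => by
    have := hbig k
    rw [eq_neg_of_add_eq_zero_left h, norm_neg] at this
    linarith
  have hprod : ∀ N : ℕ, ∏ k ∈ Finset.range N, (z + a + k) ≠ 0 := fun N =>
    Finset.prod_ne_zero_iff.2 fun k _ => by rw [add_right_comm]; exact ha k
  have hlim1 := (Complex.GammaSeq_tendsto_Gamma (z + a)).mul (tendsto_exp_mainPart_div a z hne)
  have hlim2 : Tendsto (fun n : ℕ => Complex.exp (mainPart a z +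
      ∑ k ∈ Finset.range (n + 1), step a (1 / (z + k)))) atTop
      (𝓝 (Complex.exp (mainPart a z + remainder a z))) :=
    (Complex.continuous_exp.tendsto _).comp (((tendsto_add_atTop_iff_nat 1).2
      (summable_step hc hz hR hz1).hasSum.tendsto_sum_nat).const_add _)
  have heq : (fun n : ℕ => Complex.GammaSeq (z + a) n *
      (Complex.exp (mainPart a (z + (n + 1 : ℕ))) / ((n : ℂ) ^ (z + a) * n.factorial))) =ᶠ[atTop]
      fun n : ℕ => Complex.exp (mainPart a z +
        ∑ k ∈ Finset.range (n + 1), step a (1 / (z + k))) := by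
    filter_upwards [eventually_ne_atTop 0] with n hn
    have hnC : (n : ℂ) ≠ 0 := by exact_mod_cast hn
    have hcp : (n : ℂ) ^ (z + a) ≠ 0 := by simp [Complex.cpow_eq_zero_iff, hnC]
    have hfac : (n.factorial : ℂ) ≠ 0 := by exact_mod_cast n.factorial_ne_zero
    have h := exp_sum_step hcone ha (n + 1)
    rw [Complex.exp_sub, eq_div_iff (Complex.exp_ne_zero _)] at h
    rw [Complex.GammaSeq, Complex.exp_add, ← h]
    have := hprod (n + 1)
    field_simp
  have hfin := tendsto_nhds_unique (hlim1.congr' heq) hlim2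
  have hsq : Complex.exp ((1 / 2 * Real.log (2 * Real.pi) : ℝ) : ℂ) = (√(2 * Real.pi) : ℝ) := by
    rw [← Complex.ofReal_exp, Real.sqrt_eq_rpow, Real.rpow_def_of_pos (by positivity), mul_comm]
  have hsq0 : ((√(2 * Real.pi) : ℝ) : ℂ) ≠ 0 := by
    exact_mod_cast (show √(2 * Real.pi) ≠ 0 by positivity)
  rw [add_assoc, Complex.exp_add, hsq, ← hfin]
  field_simp

/-! ### Cones and Gevrey bounds -/

theorem sq_norm_add_ofReal (z : ℂ) (t : ℝ) :
    ‖z + t‖ ^ 2 = ‖z‖ ^ 2 + 2 * t * z.re + t ^ 2 := by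
  rw [Complex.sq_norm, Complex.sq_norm, Complex.normSq_apply, Complex.normSq_apply]
  simp
  ring

theorem openSector_subset_cone {δ : ℝ} (hδ : 0 < δ) (hδ' : δ < Real.pi) :
    openSector δ ⊆ cone (Real.sin (δ / 2)) := by
  rintro z ⟨hz0, hz⟩ t ht
  have hz' : 0 < ‖z‖ := norm_pos_iff.2 hz0
  have hs : 0 ≤ Real.sin (δ / 2) := Real.sin_nonneg_of_nonneg_of_le_pi (by linarith) (by linarith)
  have hcos : -Real.cos δ ≤ Real.cos z.arg := by
    rw [← Real.cos_abs z.arg, ← Real.cos_pi_sub]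
    exact Real.cos_le_cos_of_nonneg_of_le_pi (abs_nonneg _) (by linarith) hz.le
  have hsq : Real.sin (δ / 2) ^ 2 = (1 - Real.cos δ) / 2 := by
    rw [Real.sin_sq, Real.cos_sq, mul_div_cancel₀ δ (by norm_num)]
    ring
  have hre : z.re = ‖z‖ * Real.cos z.arg := (Complex.norm_mul_cos_arg z).symm
  refine le_of_sq_le_sq ?_ (norm_nonneg _)
  rw [mul_pow, hsq, sq_norm_add_ofReal, hre]
  have h1 := mul_le_mul_of_nonneg_left hcos (mul_nonneg ht hz'.le)
  nlinarith [mul_nonneg (show 0 ≤ 1 + Real.cos δ by linarith [Real.neg_one_le_cos δ])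
    (sq_nonneg (‖z‖ - t))]

theorem halfPlane_subset_cone {lam : ℝ} (h : 0 ≤ lam) : {z : ℂ | lam < z.re} ⊆ cone (1 / 2) := by
  intro z hz t ht
  have hz : lam < z.re := hz
  refine le_of_sq_le_sq ?_ (norm_nonneg _)
  rw [sq_norm_add_ofReal]
  have := mul_nonneg ht (h.trans hz.le)
  nlinarith [sq_nonneg (‖z‖ - t), sq_nonneg (‖z‖ + t)]

theorem mul_mem_cone {c A : ℝ} (hA : 0 < A) {z : ℂ} (hz : z ∈ cone c) : (A : ℂ) * z ∈ cone c := by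
  intro t ht
  have h := hz (t / A) (by positivity)
  have e : (A : ℂ) * z + t = A * (z + (t / A : ℝ)) := by
    have : (A : ℂ) ≠ 0 := by exact_mod_cast hA.ne'
    push_cast
    field_simp
  rw [e, norm_mul, norm_mul, Complex.norm_real, Real.norm_of_nonneg hA.le]
  calc c * (A * ‖z‖ + t) = A * (c * (‖z‖ + t / A)) := by field_simp
    _ ≤ _ := by gcongr

theorem GevreyBound.zero (c : ℝ) : GevreyBound c (fun _ => 0) (fun _ => 0) :=
  ⟨1, 1, 1, one_pos, one_pos, one_pos, fun z _ _ n _ => by simp; positivity⟩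

theorem GevreyBound.neg {c : ℝ} {f : ℂ → ℂ} {α : ℕ → ℂ} (hf : GevreyBound c f α) :
    GevreyBound c (fun z => -f z) (fun k => -α k) := by
  obtain ⟨R, M, τ, hR, hM, hτ, h⟩ := hf
  refine ⟨R, M, τ, hR, hM, hτ, fun z hz hzR n hn => ?_⟩
  have e : -f z - ∑ k ∈ Finset.range n, -α k / z ^ k =
      -(f z - ∑ k ∈ Finset.range n, α k / z ^ k) := by
    simp only [neg_div, Finset.sum_neg_distrib]
    ring
  rw [e, norm_neg]
  exact h z hz hzR n hn

theorem GevreyBound.add {c : ℝ} {f g : ℂ → ℂ} {α β : ℕ → ℂ} (hf : GevreyBound c f α)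
    (hg : GevreyBound c g β) : GevreyBound c (fun z => f z + g z) (fun k => α k + β k) := by
  obtain ⟨R, M, τ, hR, hM, hτ, h⟩ := hf
  obtain ⟨R', M', τ', hR', hM', hτ', h'⟩ := hg
  refine ⟨max R R', M + M', max τ τ', by positivity, by positivity, by positivity,
    fun z hz hzR n hn => ?_⟩
  have e : f z + g z - ∑ k ∈ Finset.range n, (α k + β k) / z ^ k =
      (f z - ∑ k ∈ Finset.range n, α k / z ^ k) + (g z - ∑ k ∈ Finset.range n, β k / z ^ k) := by
    simp only [add_div, Finset.sum_add_distrib]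
    ring
  rw [e]
  have h1 := h z hz ((le_max_left _ _).trans hzR) n hn
  have h2 := h' z hz ((le_max_right _ _).trans hzR) n hn
  calc _ ≤ _ := norm_add_le _ _
    _ ≤ M * τ ^ n * n.factorial / ‖z‖ ^ n + M' * τ' ^ n * n.factorial / ‖z‖ ^ n :=
      add_le_add h1 h2
    _ ≤ M * (max τ τ') ^ n * n.factorial / ‖z‖ ^ n +
        M' * (max τ τ') ^ n * n.factorial / ‖z‖ ^ n := by
      gcongr
      · exact le_max_left _ _
      · exact le_max_right _ _
    _ = _ := by ring

theorem GevreyBound.sum {ι : Type*} (s : Finset ι) {c : ℝ} {f : ι → ℂ → ℂ} {α : ι → ℕ → ℂ}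
    (hf : ∀ i ∈ s, GevreyBound c (f i) (α i)) :
    GevreyBound c (fun z => ∑ i ∈ s, f i z) (fun k => ∑ i ∈ s, α i k) := by
  classical
  induction s using Finset.induction_on with
  | empty => simpa using GevreyBound.zero c
  | insert i s hi ih =>
    simp only [Finset.sum_insert hi]
    exact (hf i (Finset.mem_insert_self i s)).add
      (ih fun j hj => hf j (Finset.mem_insert_of_mem hj))

theorem GevreyBound.comp_mul {c A : ℝ} (hA : 0 < A) {f : ℂ → ℂ} {α : ℕ → ℂ}
    (hf : GevreyBound c f α) :
    GevreyBound c (fun z => f (A * z)) (fun k => α k / (A : ℂ) ^ k) := by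
  obtain ⟨R, M, τ, hR, hM, hτ, h⟩ := hf
  refine ⟨R / A, M, τ / A, by positivity, hM, by positivity, fun z hz hzR n hn => ?_⟩
  have hnorm : ‖(A : ℂ) * z‖ = A * ‖z‖ := by
    rw [norm_mul, Complex.norm_real, Real.norm_of_nonneg hA.le]
  have h1 := h _ (mul_mem_cone hA hz) (by rw [hnorm]; rwa [div_le_iff₀' hA] at hzR) n hn
  have hz0 : 0 < ‖z‖ := lt_of_lt_of_le (by positivity) hzR
  rw [hnorm] at h1
  simp only [mul_pow, ← div_div] at h1
  refine h1.trans (le_of_eq ?_)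
  rw [div_pow]
  field_simp

theorem eventually_cobounded_inf_principal_iff {D : Set ℂ} {P : ℂ → Prop} :
    (∀ᶠ z in cobounded ℂ ⊓ 𝓟 D, P z) ↔ ∃ R : ℝ, ∀ z ∈ D, R ≤ ‖z‖ → P z := by
  rw [eventually_inf_principal, (hasBasis_cobounded_norm (E := ℂ)).eventually_iff]
  constructor
  · rintro ⟨R, -, h⟩
    exact ⟨R, fun z hz hR => h hR hz⟩
  · rintro ⟨R, h⟩
    exact ⟨R, trivial, fun z hR hz => h z hz hR⟩

theorem GevreyBound.isBigO {c : ℝ} {f : ℂ → ℂ} {α : ℕ → ℂ} (hf : GevreyBound c f α) {n : ℕ}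
    (hn : 1 ≤ n) : (fun z : ℂ => f z - ∑ k ∈ Finset.range n, α k / z ^ k)
      =O[cobounded ℂ ⊓ 𝓟 (cone c)] (fun z : ℂ => 1 / z ^ n) := by
  obtain ⟨R, M, τ, hR, hM, hτ, h⟩ := hf
  refine IsBigO.of_bound (M * τ ^ n * n.factorial)
    (eventually_cobounded_inf_principal_iff.2 ⟨R, fun z hz hzR => ?_⟩)
  rw [norm_div, norm_one, norm_pow, mul_one_div]
  exact h z hz hzR n hn

/-! ### The ratio of gamma functions as an exponential -/

theorem eventually_Gamma_eq_exp {c A : ℝ} (hc : 0 < c) (hA : 0 < A) (a : ℂ) :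
    ∀ᶠ z in cobounded ℂ ⊓ 𝓟 (cone c), Complex.Gamma ((A : ℂ) * z + a) =
      Complex.exp (((1 / 2 * Real.log (2 * Real.pi) : ℝ) : ℂ) +
        ((A * z + a - 1 / 2) * ((Real.log A : ℝ) + Complex.log z) - A * z) +
        remainder a (A * z)) := by
  refine eventually_cobounded_inf_principal_iff.2
    ⟨max 1 (2 * (2 + ‖a‖) / c) / A, fun z hz hR => ?_⟩
  have hz0 : z ≠ 0 := by
    have : 0 < ‖z‖ := lt_of_lt_of_le (by positivity) hR
    exact norm_pos_iff.1 this
  have hnorm : ‖(A : ℂ) * z‖ = A * ‖z‖ := by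
    rw [norm_mul, Complex.norm_real, Real.norm_of_nonneg hA.le]
  rw [div_le_iff₀' hA, ← hnorm] at hR
  rw [Gamma_add_eq_exp hc (mul_mem_cone hA hz) ((le_max_right _ _).trans hR)
    ((le_max_left _ _).trans hR), mainPart, Complex.log_ofReal_mul hA hz0]

theorem eventually_prod_Gamma_eq_exp {c : ℝ} (hc : 0 < c) {p : ℕ} {A : Fin p → ℝ}
    (hA : ∀ k, 0 < A k) (a : Fin p → ℂ) :
    ∀ᶠ z in cobounded ℂ ⊓ 𝓟 (cone c), ∏ k, Complex.Gamma ((A k : ℂ) * z + a k) =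
      Complex.exp ((p : ℂ) / 2 * (Real.log (2 * Real.pi) : ℝ) +
        z * (∑ k, (A k : ℂ) * (Real.log (A k) : ℝ)) +
        (z * Complex.log z - z) * (∑ k, (A k : ℂ)) +
        ∑ k, (Real.log (A k) : ℝ) * (a k - 1 / 2) +
        Complex.log z * (∑ k, a k - (p : ℂ) / 2) + ∑ k, remainder (a k) (A k * z)) := by
  filter_upwards [eventually_all.2 fun k => eventually_Gamma_eq_exp hc (hA k) (a k)] with z hz
  rw [Finset.prod_congr rfl fun k _ => hz k, ← Complex.exp_sum]
  congr 1
  have hp : ∀ x : ℂ, (p : ℂ) * x = ∑ _k : Fin p, x := fun x => by simp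
  rw [show (p : ℂ) / 2 * (Real.log (2 * Real.pi) : ℝ) =
      p * (1 / 2 * (Real.log (2 * Real.pi) : ℝ)) by ring, show (p : ℂ) / 2 = p * (1 / 2) by ring,
    hp, hp, ← Finset.sum_sub_distrib, Finset.mul_sum, Finset.mul_sum, Finset.mul_sum,
    ← Finset.sum_add_distrib, ← Finset.sum_add_distrib, ← Finset.sum_add_distrib,
    ← Finset.sum_add_distrib, ← Finset.sum_add_distrib]
  refine Finset.sum_congr rfl fun k _ => ?_
  push_cast
  ring

end ShiftedStirling

namespace GammaRatio

open ShiftedStirling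
open scoped Topology

variable {p q : ℕ} (A : Fin p → ℝ) (B : Fin q → ℝ) (a : Fin p → ℂ) (b : Fin q → ℂ)

/-- The logarithm of `normalizedRatio` near infinity, once all elementary factors have
cancelled. -/
def logRatio (z : ℂ) : ℂ :=
  ∑ k, remainder (a k) (A k * z) + -∑ j, remainder (b j) (B j * z)

theorem gevreyBound_logRatio {A : Fin p → ℝ} {B : Fin q → ℝ} (hA : ∀ k, 0 < A k)
    (hB : ∀ j, 0 < B j) {c : ℝ} (hc : 0 < c) :
    GevreyBound c (logRatio A B a b) (fun m => Q A B a b m / m) := by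
  have h := (GevreyBound.sum Finset.univ fun k _ =>
    (gevreyBound_remainder (a k) hc).comp_mul (hA k)).add
    (GevreyBound.sum Finset.univ fun j _ =>
      (gevreyBound_remainder (b j) hc).comp_mul (hB j)).neg
  have e : (fun m : ℕ => Q A B a b m / m) = fun m => ∑ k, coeff (a k) m / (A k : ℂ) ^ m +
      -∑ j, coeff (b j) m / (B j : ℂ) ^ m := by
    funext m
    rw [Q, ← sub_eq_add_neg, mul_sub, sub_div, Finset.mul_sum, Finset.mul_sum, Finset.sum_div,
      Finset.sum_div]
    congr 1 <;> refine Finset.sum_congr rfl fun k _ => ?_ <;>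
    rw [coeff] <;> simp only [div_eq_mul_inv, mul_inv] <;> ring
  rw [e]
  exact h

theorem nu_eq_exp {A : Fin p → ℝ} {B : Fin q → ℝ} (hA : ∀ k, 0 < A k) (hB : ∀ j, 0 < B j) :
    nu A B a b = Complex.exp (((p : ℂ) - q) / 2 * (Real.log (2 * Real.pi) : ℝ) +
      ∑ k, (Real.log (A k) : ℝ) * (a k - 1 / 2) - ∑ j, (Real.log (B j) : ℝ) * (b j - 1 / 2)) := by
  have h1 : (((2 * Real.pi) ^ (((p : ℝ) - (q : ℝ)) / 2) : ℝ) : ℂ) =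
      Complex.exp (((p : ℂ) - q) / 2 * (Real.log (2 * Real.pi) : ℝ)) := by
    rw [Real.rpow_def_of_pos (by positivity), Complex.ofReal_exp]
    push_cast
    ring_nf
  have h2 : ∀ {x : ℝ}, 0 < x → ∀ y : ℂ, (x : ℂ) ^ y = Complex.exp ((Real.log x : ℝ) * y) := by
    intro x hx y
    rw [Complex.cpow_def_of_ne_zero (by exact_mod_cast hx.ne'), Complex.ofReal_log hx.le]
  rw [nu, h1, Finset.prod_congr rfl fun k _ => h2 (hA k) _,
    Finset.prod_congr rfl fun j _ => h2 (hB j) _, ← Complex.exp_sum, ← Complex.exp_sum,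
    ← Complex.exp_add, ← Complex.exp_add, sub_eq_add_neg (_ + _), ← Finset.sum_neg_distrib]
  congr 2
  refine Finset.sum_congr rfl fun j _ => ?_
  ring

theorem rho_cpow_eq_exp {A : Fin p → ℝ} {B : Fin q → ℝ} (hA : ∀ k, 0 < A k) (hB : ∀ j, 0 < B j)
    (z : ℂ) : (rho A B : ℂ) ^ z = Complex.exp (z * (∑ k, (A k : ℂ) * (Real.log (A k) : ℝ)) -
      z * ∑ j, (B j : ℂ) * (Real.log (B j) : ℝ)) := by
  have hA' : 0 < ∏ k, A k ^ A k := Finset.prod_pos fun k _ => Real.rpow_pos_of_pos (hA k) _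
  have hB' : 0 < ∏ j, B j ^ (-B j) := Finset.prod_pos fun j _ => Real.rpow_pos_of_pos (hB j) _
  have hr : 0 < rho A B := mul_pos hA' hB'
  have hl : Real.log (rho A B) = ∑ k, A k * Real.log (A k) - ∑ j, B j * Real.log (B j) := by
    rw [rho, Real.log_mul hA'.ne' hB'.ne', Real.log_prod, Real.log_prod, sub_eq_add_neg,
      ← Finset.sum_neg_distrib]
    · congr 1
      · exact Finset.sum_congr rfl fun k _ => Real.log_rpow (hA k) _
      · exact Finset.sum_congr rfl fun j _ => by rw [Real.log_rpow (hB j), neg_mul]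
    · exact fun j _ => (Real.rpow_pos_of_pos (hB j) _).ne'
    · exact fun k _ => (Real.rpow_pos_of_pos (hA k) _).ne'
  rw [Complex.cpow_def_of_ne_zero (by exact_mod_cast hr.ne'), ← Complex.ofReal_log hr.le, hl]
  push_cast
  ring_nf

/-- The normalising factors `z^μ`, `ν` and `ρ^z` cancel the elementary part of Stirling's formula
for all the gamma factors; the terms `z log z - z` cancel because `∑ A_k = ∑ B_j`. -/
theorem eventually_normalizedRatio_eq_exp {A : Fin p → ℝ} {B : Fin q → ℝ} (hA : ∀ k, 0 < A k)
    (hB : ∀ j, 0 < B j) (hAB : ∑ k, A k = ∑ j, B j) {c : ℝ} (hc : 0 < c) :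
    ∀ᶠ z in cobounded ℂ ⊓ 𝓟 (cone c),
      normalizedRatio A B a b z = Complex.exp (logRatio A B a b z) := by
  have hAB' : ∑ k, (A k : ℂ) = ∑ j, (B j : ℂ) := by exact_mod_cast congrArg Complex.ofReal hAB
  filter_upwards [eventually_prod_Gamma_eq_exp hc hA a, eventually_prod_Gamma_eq_exp hc hB b,
    (eventually_cobounded_inf_principal_iff (D := cone c) (P := fun z => z ≠ 0)).2
      ⟨1, fun z _ hz => norm_pos_iff.1 (by linarith)⟩] with z h1 h2 hz
  rw [normalizedRatio, h1, h2, nu_eq_exp a b hA hB, rho_cpow_eq_exp hA hB,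
    Complex.cpow_def_of_ne_zero hz, mu, logRatio, ← Complex.exp_add, ← Complex.exp_sub,
    ← Complex.exp_sub, ← Complex.exp_add, hAB']
  congr 1
  ring

end GammaRatio

/-! ### Exponentials of formal power series -/

namespace ExpSeries

/-- The coefficient of `X^r` in `exp U`, written as a finite sum: for a series `U` without constant
term the powers `Uⁿ` with `n > r` do not contribute. -/
def expCoeff (U : PowerSeries ℂ) (r : ℕ) : ℂ :=
  ∑ n ∈ Finset.range (r + 1), 1 / (n.factorial : ℂ) * PowerSeries.coeff r (U ^ n)

theorem coeff_pow_eq_zero {U : PowerSeries ℂ} (hU : PowerSeries.constantCoeff U = 0) {r n : ℕ}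
    (h : r < n) : PowerSeries.coeff r (U ^ n) = 0 :=
  PowerSeries.X_pow_dvd_iff.1 (pow_dvd_pow_of_dvd (PowerSeries.X_dvd_iff.2 hU) n) r h

theorem sum_range_eq_expCoeff {U : PowerSeries ℂ} (hU : PowerSeries.constantCoeff U = 0) {r N : ℕ}
    (h : r < N) : ∑ n ∈ Finset.range N, 1 / (n.factorial : ℂ) * PowerSeries.coeff r (U ^ n) =
      expCoeff U r := by
  refine (Finset.sum_subset (Finset.range_mono h) fun n _ hn => ?_).symm
  rw [coeff_pow_eq_zero hU (by simpa using hn), mul_zero]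

/-- The recurrence coming from `(exp U)' = U' exp U`. -/
theorem succ_mul_expCoeff {U : PowerSeries ℂ} (hU : PowerSeries.constantCoeff U = 0) (r : ℕ) :
    ((r : ℂ) + 1) * expCoeff U (r + 1) = ∑ m ∈ Finset.range (r + 1),
      ((m : ℂ) + 1) * PowerSeries.coeff (m + 1) U * expCoeff U (r - m) := by
  have hterm : ∀ n : ℕ, 1 / ((n + 1).factorial : ℂ) * (((r : ℂ) + 1) *
      PowerSeries.coeff (r + 1) (U ^ (n + 1))) = ∑ m ∈ Finset.range (r + 1),
        ((m : ℂ) + 1) * PowerSeries.coeff (m + 1) U *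
          (1 / (n.factorial : ℂ) * PowerSeries.coeff (r - m) (U ^ n)) := by
    intro n
    have h1 := PowerSeries.coeff_derivative (U ^ (n + 1)) r
    rw [Derivation.leibniz_pow, Nat.add_sub_cancel, smul_eq_mul, map_nsmul, mul_comm (U ^ n),
      PowerSeries.coeff_mul, Finset.Nat.sum_antidiagonal_eq_sum_range_succ_mk] at h1
    rw [mul_comm ((r : ℂ) + 1), ← h1, Nat.factorial_succ, nsmul_eq_mul, Finset.mul_sum,
      Finset.mul_sum]
    refine Finset.sum_congr rfl fun m _ => ?_
    have hn : (n : ℂ) + 1 ≠ 0 := by exact_mod_cast n.succ_ne_zero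
    have hf : (n.factorial : ℂ) ≠ 0 := by exact_mod_cast n.factorial_ne_zero
    rw [PowerSeries.coeff_derivative]
    push_cast
    field_simp
  rw [expCoeff, Finset.sum_range_succ', pow_zero, PowerSeries.coeff_one, if_neg r.succ_ne_zero,
    mul_zero, add_zero, Finset.mul_sum]
  simp_rw [mul_left_comm ((r : ℂ) + 1)]
  rw [Finset.sum_congr rfl fun n _ => hterm n, Finset.sum_comm]
  refine Finset.sum_congr rfl fun m _ => ?_
  rw [← Finset.mul_sum, sum_range_eq_expCoeff hU (by omega)]

theorem expCoeff_zero (U : PowerSeries ℂ) : expCoeff U 0 = 1 := by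
  simp [expCoeff]

/-- The recurrence of `succ_mul_expCoeff` determines the coefficients. -/
theorem eq_expCoeff {C u : ℕ → ℂ} (h0 : C 0 = 1) (hu : u 0 = 0)
    (hC : ∀ r : ℕ, ((r : ℂ) + 1) * C (r + 1) =
      ∑ m ∈ Finset.range (r + 1), ((m : ℂ) + 1) * u (m + 1) * C (r - m)) (r : ℕ) :
    C r = expCoeff (PowerSeries.mk u) r := by
  induction r using Nat.strong_induction_on with
  | _ r ih =>
    rcases r with _ | r
    · rw [h0, expCoeff_zero]
    · have hr : (r : ℂ) + 1 ≠ 0 := by exact_mod_cast r.succ_ne_zero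
      refine mul_left_cancel₀ hr ?_
      rw [hC, succ_mul_expCoeff (by simpa using hu)]
      refine Finset.sum_congr rfl fun m _ => ?_
      rw [PowerSeries.coeff_mk, ih (r - m) (by omega)]

/-- The coefficients of a power of a series without constant term, as sums over compositions. -/
theorem coeff_mk_pow_eq_sum_compositions {u : ℕ → ℂ} (hu : u 0 = 0) (n r : ℕ) :
    PowerSeries.coeff r (PowerSeries.mk u ^ n) =
      ∑ k ∈ Finset.piAntidiag (Finset.univ : Finset (Fin n)) r with ∀ i, 1 ≤ k i,
        ∏ i, u (k i) := by
  have h1 : PowerSeries.mk u ^ n = ∏ _i : Fin n, PowerSeries.mk u := by simp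
  rw [h1, PowerSeries.coeff_prod, Finset.sum_filter_of_ne]
  · exact Finset.sum_equiv Finsupp.equivFunOnFinite (by simp) fun _ _ => by simp
  · intro k _ hk i
    by_contra! hi
    exact hk (Finset.prod_eq_zero (Finset.mem_univ i) (by rw [Nat.lt_one_iff.1 hi, hu]))

/-- The coefficients of `exp U` as sums over partitions: `U` may be truncated at `X^r`, and the
multinomial theorem expands the powers of the resulting polynomial. -/
theorem expCoeff_mk_eq_sum_partitions {u : ℕ → ℂ} (hu : u 0 = 0) (r : ℕ) :
    expCoeff (PowerSeries.mk u) r =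
      ∑ k ∈ (Fintype.piFinset fun _ : Fin r => Finset.range (r + 1)) with
          ∑ i, (i.1 + 1) * k i = r,
        ∏ i, u (i.1 + 1) ^ k i / ((k i).factorial : ℂ) := by
  set V : PowerSeries ℂ := ∑ i : Fin r, PowerSeries.monomial (i.1 + 1) (u (i.1 + 1)) with hV
  have hdvd : (PowerSeries.X : PowerSeries ℂ) ^ (r + 1) ∣ PowerSeries.mk u - V := by
    rw [PowerSeries.X_pow_dvd_iff]
    intro m hm
    rw [map_sub, PowerSeries.coeff_mk, hV, map_sum, sub_eq_zero]
    simp only [PowerSeries.coeff_monomial]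
    rcases m with _ | m
    · simp [hu]
    · rw [Finset.sum_eq_single (⟨m, by omega⟩ : Fin r)]
      · simp
      · intro i _ hi
        rw [if_neg fun h => hi (Fin.ext (by simp only; omega))]
      · simp
  have hpow : ∀ n, PowerSeries.coeff r (PowerSeries.mk u ^ n) = PowerSeries.coeff r (V ^ n) := by
    intro n
    rw [← sub_eq_zero, ← map_sub]
    exact PowerSeries.X_pow_dvd_iff.1 (hdvd.trans (sub_dvd_pow_sub_pow _ _ n)) r (by omega)
  have hVn : ∀ n, 1 / (n.factorial : ℂ) * PowerSeries.coeff r (V ^ n) =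
      ∑ k ∈ (Finset.piAntidiag (Finset.univ : Finset (Fin r)) n) with ∑ i, (i.1 + 1) * k i = r,
        ∏ i, u (i.1 + 1) ^ k i / ((k i).factorial : ℂ) := by
    intro n
    rw [hV, Finset.sum_pow_eq_sum_piAntidiag, map_sum, Finset.mul_sum, Finset.sum_filter]
    refine Finset.sum_congr rfl fun k hk => ?_
    have hprod : ∏ i, PowerSeries.monomial (R := ℂ) (i.1 + 1) (u (i.1 + 1)) ^ k i =
        PowerSeries.monomial (∑ i : Fin r, (i.1 + 1) * k i) (∏ i, u (i.1 + 1) ^ k i) := by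
      simp_rw [PowerSeries.monomial_pow, PowerSeries.prod_monomial, mul_comm]
    have hfac : ((∏ i, (k i).factorial : ℕ) : ℂ) * (Nat.multinomial Finset.univ k : ℂ) =
        n.factorial := by
      have h := Nat.multinomial_spec Finset.univ k
      rw [(Finset.mem_piAntidiag.1 hk).1] at h
      exact_mod_cast h
    have hn : (n.factorial : ℂ) ≠ 0 := by exact_mod_cast n.factorial_ne_zero
    have hk0 : ((∏ i, (k i).factorial : ℕ) : ℂ) ≠ 0 := by
      exact_mod_cast Finset.prod_ne_zero_iff.2 fun i _ => (k i).factorial_ne_zero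
    rw [hprod, ← nsmul_eq_mul, map_nsmul, PowerSeries.coeff_monomial, nsmul_eq_mul,
      Finset.prod_div_distrib]
    push_cast at hk0 hfac
    split_ifs with h1 h2 h2
    · rw [← hfac]
      have hm : (Nat.multinomial Finset.univ k : ℂ) ≠ 0 := fun h => hn (by rw [← hfac, h, mul_zero])
      field_simp
    · exact absurd h1.symm h2
    · exact absurd h2.symm h1
    · simp
  rw [expCoeff, Finset.sum_congr rfl fun n _ => by rw [hpow, hVn]]
  rw [← Finset.sum_biUnion]
  · refine Finset.sum_congr ?_ fun _ _ => rfl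
    ext k
    have hle : ∑ i, k i ≤ ∑ i : Fin r, (i.1 + 1) * k i :=
      Finset.sum_le_sum fun i _ => Nat.le_mul_of_pos_left _ (by omega)
    have hle' : ∀ i, k i ≤ ∑ i, k i := fun i =>
      Finset.single_le_sum (f := k) (fun _ _ => Nat.zero_le _) (Finset.mem_univ i)
    simp only [Finset.mem_biUnion, Finset.mem_range, Finset.mem_filter, Finset.mem_piAntidiag,
      Finset.mem_univ, implies_true, and_true, Fintype.mem_piFinset]
    constructor
    · rintro ⟨n, hn, h1, h2⟩
      exact ⟨fun i => by have := hle' i; omega, h2⟩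
    · rintro ⟨-, h2⟩
      exact ⟨∑ i, k i, by omega, rfl, h2⟩
  · intro n _ n' _ hne
    refine Finset.disjoint_left.2 fun k h1 h2 => hne ?_
    rw [← (Finset.mem_piAntidiag.1 (Finset.mem_filter.1 h1).1).1,
      ← (Finset.mem_piAntidiag.1 (Finset.mem_filter.1 h2).1).1]

/-! ### Exponentials of asymptotic expansions -/

open scoped Topology

/-- If `P` and `S` are the truncations of `U` and of `exp U`, then `exp P - S = O(w^(n+1))` at `0`,
since `(S e^{-P})' = (S' - P' S) e^{-P}` vanishes to order `n`. -/
theorem isBigO_exp_sum_sub_sum {C u : ℕ → ℂ} (h0 : C 0 = 1) (hu : u 0 = 0)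
    (hC : ∀ r : ℕ, ((r : ℂ) + 1) * C (r + 1) =
      ∑ m ∈ Finset.range (r + 1), ((m : ℂ) + 1) * u (m + 1) * C (r - m)) (n : ℕ) :
    (fun w : ℂ => Complex.exp (∑ k ∈ Finset.range (n + 1), u k * w ^ k) -
      ∑ k ∈ Finset.range (n + 1), C k * w ^ k) =O[𝓝 0] fun w => w ^ (n + 1) := by
  set P : Polynomial ℂ := ∑ k ∈ Finset.range (n + 1), Polynomial.monomial k (u k) with hP
  set S : Polynomial ℂ := ∑ k ∈ Finset.range (n + 1), Polynomial.monomial k (C k) with hS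
  have hPc : ∀ j < n + 1, P.coeff j = u j := fun j hj => by
    simp [hP, Polynomial.coeff_monomial]; omega
  have hSc : ∀ j < n + 1, S.coeff j = C j := fun j hj => by
    simp [hS, Polynomial.coeff_monomial]; omega
  have hPe : ∀ w, ∑ k ∈ Finset.range (n + 1), u k * w ^ k = P.eval w := fun w => by
    simp [hP, Polynomial.eval_finsetSum]
  have hSe : ∀ w, ∑ k ∈ Finset.range (n + 1), C k * w ^ k = S.eval w := fun w => by
    simp [hS, Polynomial.eval_finsetSum]
  obtain ⟨q, hq⟩ : Polynomial.X ^ n ∣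
      Polynomial.derivative S - Polynomial.derivative P * S := by
    rw [Polynomial.X_pow_dvd_iff]
    intro d hd
    rw [Polynomial.coeff_sub, Polynomial.coeff_mul,
      Finset.Nat.sum_antidiagonal_eq_sum_range_succ_mk, Polynomial.coeff_derivative,
      hSc _ (by omega), mul_comm, hC, sub_eq_zero]
    refine Finset.sum_congr rfl fun m hm => ?_
    have := Finset.mem_range.1 hm
    rw [Polynomial.coeff_derivative, hPc _ (by omega), hSc _ (by omega)]
    ring
  have hder : ∀ w : ℂ, HasDerivAt (fun w => S.eval w * Complex.exp (-P.eval w))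
      (w ^ n * (q.eval w * Complex.exp (-P.eval w))) w := by
    intro w
    have h := (S.hasDerivAt w).mul (P.hasDerivAt w).neg.cexp
    have e := congrArg (Polynomial.eval w) hq
    simp only [Polynomial.eval_sub, Polynomial.eval_mul, Polynomial.eval_pow, Polynomial.eval_X]
      at e
    refine h.congr_deriv ?_
    simp only [Pi.neg_apply]
    linear_combination Complex.exp (-P.eval w) * e
  have hcont : Continuous fun w : ℂ => q.eval w * Complex.exp (-P.eval w) := by
    have := q.continuous
    have := P.continuous
    fun_prop
  obtain ⟨K, hK⟩ := (isCompact_closedBall (0 : ℂ) 1).exists_bound_of_continuousOn hcont.continuousOn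
  have hK0 : 0 ≤ K := (norm_nonneg _).trans (hK 0 (by simp))
  have hPcont : Continuous fun w : ℂ => Complex.exp (P.eval w) := by
    have := P.continuous
    fun_prop
  have hG : (fun w : ℂ => 1 - S.eval w * Complex.exp (-P.eval w)) =O[𝓝 0]
      fun w => w ^ (n + 1) := by
    refine IsBigO.of_bound K ?_
    filter_upwards [Metric.closedBall_mem_nhds (0 : ℂ) one_pos] with w hw
    have hw1 : ‖w‖ ≤ 1 := by simpa using hw
    have h := (convex_closedBall (0 : ℂ) ‖w‖).norm_image_sub_le_of_norm_hasDerivWithin_le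
      (C := K * ‖w‖ ^ n) (fun x _ => (hder x).hasDerivWithinAt) (fun x hx => by
        have hx' : ‖x‖ ≤ ‖w‖ := by simpa using hx
        rw [norm_mul, norm_pow, mul_comm]
        gcongr
        exact hK x (by simpa using hx'.trans hw1)) (x := w) (y := 0) (by simp) (by simp)
    have e0 : S.eval 0 * Complex.exp (-P.eval 0) = 1 := by
      rw [← Polynomial.coeff_zero_eq_eval_zero, ← Polynomial.coeff_zero_eq_eval_zero,
        hPc 0 (by omega), hSc 0 (by omega), h0, hu, neg_zero, Complex.exp_zero, one_mul]
    rw [e0, zero_sub, norm_neg] at h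
    rw [norm_pow, pow_succ, ← mul_assoc]
    exact h
  have hb : (fun w : ℂ => Complex.exp (P.eval w)) =O[𝓝 0] fun _ => (1 : ℂ) :=
    hPcont.continuousAt.norm.isBoundedUnder_le.isBigO_one ℂ
  have := hb.mul hG
  simp only [one_mul] at this
  refine this.congr_left fun w => ?_
  rw [hPe, hSe, mul_sub, mul_one, mul_left_comm, ← Complex.exp_add, add_neg_cancel,
    Complex.exp_zero, mul_one]

theorem tendsto_one_div_pow_succ (D : Set ℂ) (n : ℕ) :
    Tendsto (fun z : ℂ => 1 / z ^ (n + 1)) (cobounded ℂ ⊓ 𝓟 D) (𝓝 0) := by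
  have := ((tendsto_inv₀_cobounded (α := ℂ)).mono_left (inf_le_left (b := 𝓟 D))).pow (n + 1)
  simpa using this

theorem tendsto_of_isBigO_one {f : ℂ → ℂ} {α : ℕ → ℂ} {D : Set ℂ}
    (h : (fun z : ℂ => f z - ∑ k ∈ Finset.range 1, α k / z ^ k)
      =O[cobounded ℂ ⊓ 𝓟 D] (fun z : ℂ => 1 / z ^ 1)) :
    Tendsto f (cobounded ℂ ⊓ 𝓟 D) (𝓝 (α 0)) := by
  have := (h.trans_tendsto (tendsto_one_div_pow_succ D 0)).add_const (α 0)
  simpa using this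

theorem hasPoincareExpansion_of_isBigO_succ {f : ℂ → ℂ} {α : ℕ → ℂ} {D : Set ℂ}
    (h : ∀ n : ℕ, (fun z : ℂ => f z - ∑ k ∈ Finset.range (n + 1), α k / z ^ k)
      =O[cobounded ℂ ⊓ 𝓟 D] (fun z : ℂ => 1 / z ^ (n + 1))) : HasPoincareExpansion f α D := by
  rintro (_ | n)
  · simpa using (tendsto_of_isBigO_one (h 0)).norm.isBoundedUnder_le.isBigO_one ℂ
  · exact h n

/-- An asymptotic expansion `L ∼ ∑ u_m z^{-m}` without constant term can be exponentiated. -/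
theorem hasPoincareExpansion_of_eventually_eq_exp {C u : ℕ → ℂ} (h0 : C 0 = 1) (hu : u 0 = 0)
    (hC : ∀ r : ℕ, ((r : ℂ) + 1) * C (r + 1) =
      ∑ m ∈ Finset.range (r + 1), ((m : ℂ) + 1) * u (m + 1) * C (r - m)) {D : Set ℂ} {f L : ℂ → ℂ}
    (hf : ∀ᶠ z in cobounded ℂ ⊓ 𝓟 D, f z = Complex.exp (L z))
    (hL : ∀ n : ℕ, 1 ≤ n → (fun z : ℂ => L z - ∑ k ∈ Finset.range n, u k / z ^ k)
      =O[cobounded ℂ ⊓ 𝓟 D] (fun z : ℂ => 1 / z ^ n)) :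
    HasPoincareExpansion f C D := by
  have hinv : Tendsto (fun z : ℂ => 1 / z) (cobounded ℂ ⊓ 𝓟 D) (𝓝 0) := by
    simp only [one_div]
    exact tendsto_inv₀_cobounded.mono_left inf_le_left
  have hpow := tendsto_one_div_pow_succ D
  have hsucc : ∀ n : ℕ, (fun z : ℂ => f z - ∑ k ∈ Finset.range (n + 1), C k / z ^ k)
      =O[cobounded ℂ ⊓ 𝓟 D] (fun z : ℂ => 1 / z ^ (n + 1)) := by
    intro n
    set P : ℂ → ℂ := fun w => ∑ k ∈ Finset.range (n + 1), u k * w ^ k with hP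
    have hPz : ∀ z : ℂ, ∑ k ∈ Finset.range (n + 1), u k / z ^ k = P (1 / z) := fun z => by
      simp [hP, div_eq_mul_inv]
    have hSz : ∀ z : ℂ, ∑ k ∈ Finset.range (n + 1), C k / z ^ k =
        ∑ k ∈ Finset.range (n + 1), C k * (1 / z) ^ k := fun z => by
      simp [div_eq_mul_inv]
    have h1 := (isBigO_exp_sum_sub_sum h0 hu hC n).comp_tendsto hinv
    have h2 := hL (n + 1) (by omega)
    simp only [hPz] at h2
    have h3 : (fun z => Complex.exp (L z - P (1 / z)) - 1) =O[cobounded ℂ ⊓ 𝓟 D]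
        fun z => 1 / z ^ (n + 1) := by
      have hd : (fun x : ℂ => Complex.exp x - 1) =O[𝓝 0] fun x => x := by
        simpa using (Complex.hasDerivAt_exp 0).isBigO_sub
      exact (hd.comp_tendsto (h2.trans_tendsto (hpow n))).trans h2
    have hcont : Continuous fun w => Complex.exp (P w) := by fun_prop
    have h4 : (fun z : ℂ => Complex.exp (P (1 / z))) =O[cobounded ℂ ⊓ 𝓟 D] fun _ => (1 : ℂ) :=
      ((hcont.tendsto 0).comp hinv).norm.isBoundedUnder_le.isBigO_one ℂ
    have h5 := h4.mul h3
    simp only [one_mul] at h5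
    have h1' : (fun z : ℂ => Complex.exp (P (1 / z)) -
        ∑ k ∈ Finset.range (n + 1), C k * (1 / z) ^ k) =O[cobounded ℂ ⊓ 𝓟 D]
        fun z => 1 / z ^ (n + 1) := by
      refine h1.congr (fun z => rfl) fun z => ?_
      simp
    refine (h5.add h1').congr' ?_ EventuallyEq.rfl
    filter_upwards [hf] with z hz
    rw [hz, hSz, mul_sub, ← Complex.exp_add]
    ring_nf
  exact hasPoincareExpansion_of_isBigO_succ hsucc

end ExpSeries

/-! ### The expansions of the ratio and of its logarithm -/

namespace GammaRatio

open ShiftedStirling ExpSeries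
open scoped Topology

variable {p q : ℕ} (A : Fin p → ℝ) (B : Fin q → ℝ) (a : Fin p → ℂ) (b : Fin q → ℂ)

theorem succ_mul_C (r : ℕ) : ((r : ℂ) + 1) * C A B a b (r + 1) =
    ∑ m ∈ Finset.range (r + 1),
      ((m : ℂ) + 1) * (Q A B a b (m + 1) / ((m + 1 : ℕ) : ℂ)) * C A B a b (r - m) := by
  have hr : (r : ℂ) + 1 ≠ 0 := by exact_mod_cast r.succ_ne_zero
  rw [C_succ, ← mul_assoc, mul_one_div_cancel hr, one_mul]
  refine Finset.sum_congr rfl fun m _ => ?_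
  have hm : (m : ℂ) + 1 ≠ 0 := by exact_mod_cast m.succ_ne_zero
  push_cast
  rw [mul_div_cancel₀ _ hm]

theorem C_eq_sum_Icc {r : ℕ} (hr : 1 ≤ r) : C A B a b r =
    1 / (r : ℂ) * ∑ m ∈ Finset.Icc 1 r, Q A B a b m * C A B a b (r - m) := by
  obtain ⟨r, rfl⟩ := Nat.exists_eq_add_of_le' hr
  rw [C_succ, ← Finset.Ico_add_one_right_eq_Icc, Finset.sum_Ico_eq_sum_range]
  push_cast
  congr 1
  refine Finset.sum_congr (by simp) fun m _ => ?_
  rw [add_comm 1 m, Nat.add_sub_add_right]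

theorem C_eq_expCoeff (r : ℕ) :
    C A B a b r = expCoeff (PowerSeries.mk fun m => Q A B a b m / (m : ℂ)) r :=
  eq_expCoeff (u := fun m => Q A B a b m / (m : ℂ)) (C_zero A B a b) (by simp)
    (succ_mul_C A B a b) r

theorem C_eq_sum_compositions {r : ℕ} (hr : 1 ≤ r) : C A B a b r =
    ∑ n ∈ Finset.Icc 1 r, 1 / (n.factorial : ℂ) *
      ∑ k ∈ Finset.piAntidiag (Finset.univ : Finset (Fin n)) r with ∀ i, 1 ≤ k i,
        ∏ i, Q A B a b (k i) / ((k i : ℕ) : ℂ) := by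
  rw [C_eq_expCoeff, expCoeff, Finset.sum_range_succ', pow_zero, PowerSeries.coeff_one,
    if_neg (by omega), mul_zero, add_zero, ← Finset.Ico_add_one_right_eq_Icc,
    Finset.sum_Ico_eq_sum_range, Nat.add_sub_cancel]
  refine Finset.sum_congr rfl fun n _ => ?_
  rw [add_comm 1 n, coeff_mk_pow_eq_sum_compositions (by simp)]

variable {A B}

theorem hasPoincareExpansion_normalizedRatio (hA : ∀ k, 0 < A k) (hB : ∀ j, 0 < B j)
    (hAB : ∑ k, A k = ∑ j, B j) {c : ℝ} (hc : 0 < c) :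
    HasPoincareExpansion (normalizedRatio A B a b) (C A B a b) (cone c) :=
  hasPoincareExpansion_of_eventually_eq_exp (u := fun m => Q A B a b m / (m : ℂ))
    (C_zero A B a b) (by simp) (succ_mul_C A B a b)
    (eventually_normalizedRatio_eq_exp a b hA hB hAB hc)
    fun _ hn => (gevreyBound_logRatio a b hA hB hc).isBigO hn

/-- Near infinity the exponent `logRatio` tends to `0`, hence it is the principal logarithm. -/
theorem eventually_log_normalizedRatio (hA : ∀ k, 0 < A k) (hB : ∀ j, 0 < B j)
    (hAB : ∑ k, A k = ∑ j, B j) {c : ℝ} (hc : 0 < c) :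
    ∀ᶠ z in cobounded ℂ ⊓ 𝓟 (cone c),
      Complex.log (normalizedRatio A B a b z) = logRatio A B a b z := by
  have h := tendsto_of_isBigO_one ((gevreyBound_logRatio a b hA hB hc).isBigO le_rfl)
  simp only [Nat.cast_zero, div_zero] at h
  filter_upwards [eventually_normalizedRatio_eq_exp a b hA hB hAB hc,
    h (Metric.ball_mem_nhds 0 Real.pi_pos)] with z hz hball
  have him : |(logRatio A B a b z).im| < Real.pi :=
    (Complex.abs_im_le_norm _).trans_lt (by simpa using hball)
  rw [hz, Complex.log_exp (abs_lt.1 him).1 (abs_lt.1 him).2.le]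

theorem log_normalizedRatio_mem_gevreyClass (hA : ∀ k, 0 < A k) (hB : ∀ j, 0 < B j)
    (hAB : ∑ k, A k = ∑ j, B j) :
    (fun z : ℂ => Complex.log (normalizedRatio A B a b z)) ∈ GevreyClass := by
  have hc : (0 : ℝ) < 1 / 2 := by norm_num
  have hG := gevreyBound_logRatio a b hA hB hc
  have hlog := eventually_log_normalizedRatio a b hA hB hAB hc
  obtain ⟨R₁, h₁⟩ := eventually_cobounded_inf_principal_iff.1 hlog
  obtain ⟨R, M, τ, hR, hM, hτ, h⟩ := id hG
  have hD : {z : ℂ | max R R₁ < z.re} ⊆ cone (1 / 2) :=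
    halfPlane_subset_cone (hR.le.trans (le_max_left _ _))
  refine ⟨max R R₁, fun m => Q A B a b m / m, hasPoincareExpansion_of_isBigO_succ fun n => ?_,
    M, τ, hM, hτ, fun z hz n hn => ?_⟩
  · refine IsBigO.mono ?_ (inf_le_inf_left _ (principal_mono.2 hD))
    refine (hG.isBigO (Nat.succ_pos n)).congr' ?_ EventuallyEq.rfl
    filter_upwards [hlog] with z hz
    rw [hz]
  · have hre : max R R₁ ≤ ‖z‖ := (le_of_lt hz).trans (Complex.re_le_norm z)
    simp only
    rw [h₁ z (hD hz) ((le_max_right _ _).trans hre)]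
    exact h z (hD hz) ((le_max_left _ _).trans hre) n hn

end GammaRatio

end

theorem mainTheorem4 {p q : ℕ} (A : Fin p → ℝ) (B : Fin q → ℝ) (a : Fin p → ℂ) (b : Fin q → ℂ)
    (hA : ∀ k, 0 < A k) (hB : ∀ j, 0 < B j) (hAB : ∑ k, A k = ∑ j, B j) :
    -- the asymptotic expansion in each sector
    (∀ δ : ℝ, 0 < δ → δ < Real.pi →
      HasPoincareExpansion (GammaRatio.normalizedRatio A B a b) (GammaRatio.C A B a b)
        (openSector δ)) ∧
    -- the recurrence for the coefficients
    GammaRatio.C A B a b 0 = 1 ∧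
    (∀ r : ℕ, 1 ≤ r → GammaRatio.C A B a b r =
      1 / (r : ℂ) * ∑ m ∈ Finset.Icc 1 r, GammaRatio.Q A B a b m * GammaRatio.C A B a b (r - m)) ∧
    -- the two explicit expressions for the coefficients, in terms of `u_m = Q_m / m`
    (∀ r : ℕ, GammaRatio.C A B a b r =
      ∑ k ∈ (Fintype.piFinset fun _ : Fin r => Finset.range (r + 1)) with
          ∑ i, (i.1 + 1) * k i = r,
        ∏ i, (GammaRatio.Q A B a b (i.1 + 1) / ((i.1 + 1 : ℕ) : ℂ)) ^ k i /
          ((k i).factorial : ℂ)) ∧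
    (∀ r : ℕ, 1 ≤ r → GammaRatio.C A B a b r =
      ∑ n ∈ Finset.Icc 1 r, 1 / (n.factorial : ℂ) *
        ∑ k ∈ Finset.piAntidiag (Finset.univ : Finset (Fin n)) r with ∀ i, 1 ≤ k i,
          ∏ i, GammaRatio.Q A B a b (k i) / ((k i : ℕ) : ℂ)) ∧
    -- the (principal) logarithm belongs to the class `𝒢`
    (fun z : ℂ => Complex.log (GammaRatio.normalizedRatio A B a b z)) ∈ GevreyClass := by
  refine ⟨fun δ hδ hδ' n => ?_, GammaRatio.C_zero A B a b,
    fun r hr => GammaRatio.C_eq_sum_Icc A B a b hr, fun r => ?_,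
    fun r hr => GammaRatio.C_eq_sum_compositions A B a b hr,
    GammaRatio.log_normalizedRatio_mem_gevreyClass a b hA hB hAB⟩
  · have hc : 0 < Real.sin (δ / 2) := Real.sin_pos_of_pos_of_lt_pi (by linarith) (by linarith)
    exact (GammaRatio.hasPoincareExpansion_normalizedRatio a b hA hB hAB hc n).mono
      (inf_le_inf_left _ (principal_mono.2 (ShiftedStirling.openSector_subset_cone hδ hδ')))
  · rw [GammaRatio.C_eq_expCoeff]
    exact ExpSeries.expCoeff_mk_eq_sum_partitions
      (u := fun m => GammaRatio.Q A B a b m / (m : ℂ)) (by simp) r
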